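/- Let $q$ be a power of $2$, let $V=\mathbb F_q^4$ with its standard nondegenerate alternating form, and let $G$ be an almost simple group (that is, $G$ has a unique minimal normal subgroup, and this is nonabelian simple) whose socle is $L=\mathrm{PSp}_4(q)=\mathrm{Sp}(V)/Z(\mathrm{Sp}(V))$. Let $\Gamma$ be a finite digraph (an irreflexive and anti-symmetric relation $\to$ on a finite vertex set), every vertex of which has at least $3$ out-neighbours. Suppose that $G\leqslant\mathrm{Aut}(\Gamma)$ acts primitively on the vertices of $\Gamma$. Suppose that for some vertex $v$ the stabiliser $G_v$ is a maximal $\mathcal A_2$-subgroup of $G$, that is, $G_v$ is a maximal subgroup of $G$ and $G_v=N_G(\overline M)$, where $\overline M$ is the image in $L$ of a subgroup $M=M_1\times M_2\leqslant \mathrm{Sp}(V_1)\times\mathrm{Sp}(V_2)\leqslant\mathrm{Sp}(V)$, with $V=V_1\perp V_2$ an orthogonal decomposition into nondegenerate $2$-dimensional subspaces, and where either $q>4$ and $M_1\cong M_2\cong C_{q-1}$, or $M_1\cong M_2\cong C_{q+1}$. Then $\Gamma$ is not $(G,3)$-arc-transitive: $G$ is not transitive on the set of sequences $(v_0,v_1,v_2,v_3)$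 of vertices with $v_0\to v_1\to v_2\to v_3$. -/

import Mathlib

namespace ArcTransitive

/-! ### Digraphs and arc-transitivity -/

section Digraphs

variable {Ω : Type*}

/-- The adjacency relation is irreflexive and anti-symmetric: there are no loops and at most one
of `u → v`, `v → u` holds. -/
def IsOriented (Γ : Digraph Ω) : Prop :=
  (∀ v, ¬ Γ.Adj v v) ∧ ∀ u v, Γ.Adj u v → ¬ Γ.Adj v u

/-- The number of out-neighbours of `v`. -/
noncomputable def outValency (Γ : Digraph Ω) (v : Ω) : ℕ :=
  Nat.card {w : Ω // Γ.Adj v w}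

/-- An `s`-arc `v₀ → v₁ → ⋯ → vₛ`. -/
def IsArc (Γ : Digraph Ω) (s : ℕ) (a : Fin (s + 1) → Ω) : Prop :=
  ∀ i : Fin s, Γ.Adj (a i.castSucc) (a i.succ)

/-- `G` acts on the vertices by automorphisms of the digraph. -/
def ActsByAut (G : Type*) [Group G] [MulAction G Ω] (Γ : Digraph Ω) : Prop :=
  ∀ (g : G) (u v : Ω), Γ.Adj (g • u) (g • v) ↔ Γ.Adj u v

/-- `Γ` is `(G, s)`-arc-transitive: `G` is transitive on the set of `s`-arcs of `Γ`. -/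
def IsArcTransitive (G : Type*) [Group G] [MulAction G Ω] (Γ : Digraph Ω) (s : ℕ) : Prop :=
  ∀ a b : Fin (s + 1) → Ω, IsArc Γ s a → IsArc Γ s b → ∃ g : G, ∀ i, g • a i = b i

end Digraphs

/-! ### Almost simple groups -/

section AlmostSimple

/-- `N` is a minimal normal subgroup of `G`. -/
def IsMinimalNormal {G : Type*} [Group G] (N : Subgroup G) : Prop :=
  N.Normal ∧ N ≠ ⊥ ∧ ∀ K : Subgroup G, K.Normal → K ≠ ⊥ → K ≤ N → K = N

/-- The socle: the subgroup generated by the minimal normal subgroups. -/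
def socle (G : Type*) [Group G] : Subgroup G :=
  sSup {N : Subgroup G | IsMinimalNormal N}

/-- `G` has a unique minimal normal subgroup, and this is a nonabelian simple group. -/
def IsAlmostSimple (G : Type*) [Group G] : Prop :=
  ∃ T : Subgroup G, IsMinimalNormal T ∧ (∀ N : Subgroup G, IsMinimalNormal N → N = T) ∧
    IsSimpleGroup T ∧ ¬ IsMulCommutative T

end AlmostSimple

/-! ### The symplectic groups in dimension four and the class `A₂` -/

section Symplectic

variable (F : Type*) [Field F]

/-- The symplectic group `Sp₄(F)` of the form with matrix `J = [0, -1; 1, 0]` on `F⁴`. -/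
abbrev Sp4 : Type _ := Matrix.symplecticGroup (Fin 2) F

/-- The projective symplectic group `PSp₄(F) = Sp₄(F) / Z(Sp₄(F))`. -/
abbrev PSp4 : Type _ := Sp4 F ⧸ Subgroup.center (Sp4 F)

variable {F}

/-- `g` lies in the subgroup `Sp(U) × 1` of `Sp(U) × Sp(W)`, where the symplectic space is the
orthogonal sum of `U` and `W`: it preserves `U` and fixes every vector of `W`. -/
def ActsOnlyOn (U W : Submodule F (Fin 2 ⊕ Fin 2 → F)) (g : Sp4 F) : Prop :=
  (∀ u ∈ U, Matrix.mulVec g.1 u ∈ U) ∧ ∀ w ∈ W, Matrix.mulVec g.1 w = w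

/-- `F⁴ = U ⟂ W` is an orthogonal decomposition into two (necessarily nondegenerate)
two-dimensional subspaces. -/
def IsOrthogonalDecomposition (U W : Submodule F (Fin 2 ⊕ Fin 2 → F)) : Prop :=
  Module.finrank F U = 2 ∧ Module.finrank F W = 2 ∧ IsCompl U W ∧
    ∀ u ∈ U, ∀ w ∈ W, u ⬝ᵥ Matrix.mulVec (Matrix.J (Fin 2) F) w = 0

/-- `M = M₁ × M₂ ≅ C_m × C_m`, where `M₁ ≤ Sp(U)` and `M₂ ≤ Sp(W)` are cyclic of order `m`, for
some orthogonal decomposition `F⁴ = U ⟂ W` into nondegenerate planes. So `M` lies in the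
stabiliser `Sp₂(F) ≀ S₂` of this decomposition. -/
def IsCyclicSquare (m : ℕ) (M : Subgroup (Sp4 F)) : Prop :=
  ∃ U W : Submodule F (Fin 2 ⊕ Fin 2 → F), IsOrthogonalDecomposition U W ∧
    ∃ M₁ M₂ : Subgroup (Sp4 F),
      IsCyclic M₁ ∧ Nat.card M₁ = m ∧ (∀ g ∈ M₁, ActsOnlyOn U W g) ∧
      IsCyclic M₂ ∧ Nat.card M₂ = m ∧ (∀ g ∈ M₂, ActsOnlyOn W U g) ∧
      M = M₁ ⊔ M₂

/-- The subgroups `C_{q-1}²` (for `q > 4`) and `C_{q+1}²` of `Sp₄(q)`, where `q = |F|`. -/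
def IsA2Torus (M : Subgroup (Sp4 F)) : Prop :=
  (4 < Nat.card F ∧ IsCyclicSquare (Nat.card F - 1) M) ∨ IsCyclicSquare (Nat.card F + 1) M

/-- The subgroup of `G` corresponding to the image of `M ≤ Sp₄(F)` in `PSp₄(F)`, under a given
identification of the socle of `G` with `PSp₄(F)`. -/
def inGroup {G : Type*} [Group G] (e : socle G ≃* PSp4 F) (M : Subgroup (Sp4 F)) : Subgroup G :=
  ((M.map (QuotientGroup.mk' (Subgroup.center (Sp4 F)))).comap e.toMonoidHom).map
    (socle G).subtype

/-- `H` is a maximal `A₂`-subgroup of `G`, where the socle of `G` is identified with `PSp₄(F)`: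
`H` is a maximal subgroup of `G` and it is the normaliser in `G` of one of the
subgroups `C_{q-1}²` (with `q > 4`) or `C_{q+1}²`. -/
def IsMaximalA2 {G : Type*} [Group G] (e : socle G ≃* PSp4 F) (H : Subgroup G) : Prop :=
  IsCoatom H ∧ ∃ M : Subgroup (Sp4 F), IsA2Torus M ∧
    H = Subgroup.normalizer (inGroup e M : Set G)

end Symplectic

end ArcTransitive

/-! Write q = 2ⁿ and S = Sp₄(q), which has trivial centre, so that S is the socle. The torus M is
C_m × C_m with m = q ± 1, hence m is odd and m > n. For an arc u → v put A = G_u ∩ G_v and let k be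
the out-valency. Counting orbits along a 3-arc gives |G_v| = k|A| and k³ ∣ |G_v|. Moving one step
along an arc gives g with g u = v and g v ≠ v, so that gAg⁻¹ ≤ G_v = N_G(M) although g ∉ N_G(M).

Suppose A contained the full p-torsion Q of M for some prime p ∣ m. Since N_S(M)/M has exponent
dividing 4 and p is odd, gQg⁻¹ ≤ M, so g normalises Q. But N_G(M) also normalises Q, and maximality
would make the abelian group Q normal in G, which is impossible. So A ∩ M contains no full
p-torsion; it is therefore cyclic of order dividing m (`IsTorusLike.card_comap_inf_dvd`). It follows
that m ∣ k, so m³ divides |N_G(M)|, which divides m² 2ʳ |G : S|; hence m ∣ 2ʳ |G : S|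
(`IsTorusLike.dvd_index`).

The contradiction comes from the smallness of |G : S|, which is j k' with j ≤ 2 and k' ≤ n
(`exists_index_range_eq`): m is odd, so it would divide k', yet m > n. This bound on outer
automorphisms is proved by hand. An automorphism sends transvections either to transvections or to
short root involutions, which accounts for j. One that permutes the transvections and fixes those of
a symplectic basis is a field automorphism, which accounts for k'. -/

set_option linter.unusedSectionVars false

namespace ArcTransitive

/-! ### The symplectic space F⁴ in characteristic two -/

section Form

open Matrix

variable {F : Type*} [Field F]

/-- The natural module of `Sp₄(F)`. -/
abbrev V4 (F : Type*) : Type _ := Fin 2 ⊕ Fin 2 → F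

/-- The alternating form of `F⁴` in characteristic two, in coordinates. -/
def B (x y : V4 F) : F :=
  x (.inl 0) * y (.inr 0) + x (.inl 1) * y (.inr 1) + x (.inr 0) * y (.inl 0) +
    x (.inr 1) * y (.inl 1)

lemma V4.ext {x y : V4 F} (h0 : x (.inl 0) = y (.inl 0)) (h1 : x (.inl 1) = y (.inl 1))
    (h2 : x (.inr 0) = y (.inr 0)) (h3 : x (.inr 1) = y (.inr 1)) : x = y := by
  funext i
  rcases i with i | i <;> fin_cases i <;> assumption

@[simp] lemma B_add_left (x y z : V4 F) : B (x + y) z = B x z + B y z := by simp [B]; ring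
@[simp] lemma B_add_right (x y z : V4 F) : B x (y + z) = B x y + B x z := by simp [B]; ring
@[simp] lemma B_smul_left (c : F) (x z : V4 F) : B (c • x) z = c * B x z := by simp [B]; ring
@[simp] lemma B_smul_right (c : F) (x z : V4 F) : B x (c • z) = c * B x z := by simp [B]; ring
@[simp] lemma B_zero_left (x : V4 F) : B 0 x = 0 := by simp [B]
@[simp] lemma B_zero_right (x : V4 F) : B x 0 = 0 := by simp [B]
lemma B_comm (x y : V4 F) : B x y = B y x := by simp [B]; ring
lemma B_self [CharP F 2] (x : V4 F) : B x x = 0 := by simp only [B]; grind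

lemma dotProduct_J_mulVec [CharP F 2] (x y : V4 F) : x ⬝ᵥ (J (Fin 2) F *ᵥ y) = B x y := by
  simp [J, dotProduct, mulVec, Fintype.sum_sum_type, fromBlocks, Matrix.one_apply, B]
  grind

lemma eq_zero_of_B_right {x : V4 F} (h : ∀ y, B y x = 0) : x = 0 := by
  apply V4.ext
  · simpa [B] using h (Pi.single (.inr 0) 1)
  · simpa [B] using h (Pi.single (.inr 1) 1)
  · simpa [B] using h (Pi.single (.inl 0) 1)
  · simpa [B] using h (Pi.single (.inl 1) 1)

lemma eq_of_B_right {x y : V4 F} (h : ∀ z, B z x = B z y) : x = y := by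
  rw [← sub_eq_zero]
  refine eq_zero_of_B_right fun z ↦ ?_
  rw [sub_eq_add_neg, ← neg_one_smul F y, B_add_right, B_smul_right, h]
  ring

/-- The first vector of the standard symplectic basis. -/
def e₁ : V4 F := Pi.single (.inl 0) 1
/-- The second vector of the standard symplectic basis. -/
def e₂ : V4 F := Pi.single (.inl 1) 1
/-- The third vector of the standard symplectic basis. -/
def f₁ : V4 F := Pi.single (.inr 0) 1
/-- The fourth vector of the standard symplectic basis. -/
def f₂ : V4 F := Pi.single (.inr 1) 1

@[simp] lemma B_e₁ (x : V4 F) : B x e₁ = x (.inr 0) := by simp [B, e₁]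
@[simp] lemma B_e₂ (x : V4 F) : B x e₂ = x (.inr 1) := by simp [B, e₂]
@[simp] lemma B_f₁ (x : V4 F) : B x f₁ = x (.inl 0) := by simp [B, f₁]
@[simp] lemma B_f₂ (x : V4 F) : B x f₂ = x (.inl 1) := by simp [B, f₂]

/-- The action of a symplectic matrix on the natural module. -/
def ap (g : Sp4 F) (x : V4 F) : V4 F := g.1 *ᵥ x

@[simp] lemma ap_mul (g h : Sp4 F) (x : V4 F) : ap (g * h) x = ap g (ap h x) := by
  simp [ap, Matrix.mulVec_mulVec]
@[simp] lemma ap_one (x : V4 F) : ap (1 : Sp4 F) x = x := by simp [ap]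
@[simp] lemma ap_add (g : Sp4 F) (x y : V4 F) : ap g (x + y) = ap g x + ap g y :=
  Matrix.mulVec_add ..
@[simp] lemma ap_smul (g : Sp4 F) (c : F) (x : V4 F) : ap g (c • x) = c • ap g x :=
  Matrix.mulVec_smul ..
@[simp] lemma ap_inv_ap (g : Sp4 F) (x : V4 F) : ap g⁻¹ (ap g x) = x := by
  rw [← ap_mul, inv_mul_cancel, ap_one]
@[simp] lemma ap_ap_inv (g : Sp4 F) (x : V4 F) : ap g (ap g⁻¹ x) = x := by
  rw [← ap_mul, mul_inv_cancel, ap_one]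
lemma ap_injective (g : Sp4 F) : Function.Injective (ap g) :=
  fun x y h ↦ by rw [← ap_inv_ap g x, h, ap_inv_ap]

lemma Sp4.ext_ap {g h : Sp4 F} (H : ∀ x, ap g x = ap h x) : g = h :=
  Subtype.ext (Matrix.ext_of_mulVec_single fun _ ↦ H _)

variable [CharP F 2]

@[simp] lemma B_ap_ap (g : Sp4 F) (x y : V4 F) : B (ap g x) (ap g y) = B x y := by
  rw [← dotProduct_J_mulVec, ← dotProduct_J_mulVec, ap, ap, Matrix.dotProduct_mulVec,
    Matrix.vecMul_mulVec, ← Matrix.dotProduct_mulVec, Matrix.mulVec_mulVec,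
    Matrix.dotProduct_mulVec, Matrix.dotProduct_mulVec,
    SymplecticGroup.mem_iff'.1 g.2]

lemma B_ap_left (g : Sp4 F) (x y : V4 F) : B (ap g x) y = B x (ap g⁻¹ y) := by
  rw [← B_ap_ap g x, ap_ap_inv]

/-- The symplectic matrix of a linear isometry. -/
def ofIsometry (f : V4 F →ₗ[F] V4 F) (h : ∀ x y, B (f x) (f y) = B x y) : Sp4 F :=
  ⟨LinearMap.toMatrix' f, by
    rw [SymplecticGroup.mem_iff']
    ext i j
    have := h (Pi.single i 1) (Pi.single j 1)
    rw [← dotProduct_J_mulVec, ← dotProduct_J_mulVec, ← LinearMap.toMatrix'_mulVec f,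
      ← LinearMap.toMatrix'_mulVec f, Matrix.mulVec_mulVec,
      Matrix.dotProduct_mulVec, Matrix.vecMul_mulVec, ← Matrix.dotProduct_mulVec] at this
    simpa [Matrix.mul_assoc] using this⟩

@[simp] lemma ap_ofIsometry (f : V4 F →ₗ[F] V4 F) (h : ∀ x y, B (f x) (f y) = B x y) (x : V4 F) :
    ap (ofIsometry f h) x = f x := LinearMap.toMatrix'_mulVec f x

/-- `(a, b, c, d)` is a symplectic basis with hyperbolic pairs `(a, c)` and `(b, d)`. -/
structure IsSympBasis (a b c d : V4 F) : Prop where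
  ab : B a b = 0
  ac : B a c = 1
  ad : B a d = 0
  bc : B b c = 0
  bd : B b d = 1
  cd : B c d = 0

lemma isSympBasis_std : IsSympBasis (e₁ : V4 F) e₂ f₁ f₂ := by
  constructor <;> simp <;> simp [e₁, e₂, f₁]

lemma eq_sum_std (x : V4 F) : x = x (.inl 0) • e₁ + x (.inl 1) • e₂ + x (.inr 0) • f₁ +
    x (.inr 1) • f₂ := by
  apply V4.ext <;> simp [e₁, e₂, f₁, f₂]

lemma IsSympBasis.ap {a b c d : V4 F} (h : IsSympBasis a b c d) (g : Sp4 F) :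
    IsSympBasis (ap g a) (ap g b) (ap g c) (ap g d) := by
  constructor <;> simp [h.ab, h.ac, h.ad, h.bc, h.bd, h.cd]

/-- The group acts transitively on symplectic bases. -/
lemma IsSympBasis.exists_ap {a b c d : V4 F} (h : IsSympBasis a b c d) :
    ∃ g : Sp4 F, ArcTransitive.ap g e₁ = a ∧ ArcTransitive.ap g e₂ = b ∧
      ArcTransitive.ap g f₁ = c ∧ ArcTransitive.ap g f₂ = d := by
  let f : V4 F →ₗ[F] V4 F :=
    (LinearMap.proj (.inl 0)).smulRight a + (LinearMap.proj (.inl 1)).smulRight b +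
      (LinearMap.proj (.inr 0)).smulRight c + (LinearMap.proj (.inr 1)).smulRight d
  have hf (x : V4 F) : f x = x (.inl 0) • a + x (.inl 1) • b + x (.inr 0) • c + x (.inr 1) • d :=
    rfl
  refine ⟨ofIsometry f fun x y ↦ ?_, ?_⟩
  · simp [hf, B_self, h.ab, h.ac, h.ad, h.bc, h.bd, h.cd, B_comm b a, B_comm c a, B_comm d a,
      B_comm c b, B_comm d b, B_comm d c]
    simp only [B]
    ring
  · simp [hf, e₁, e₂, f₁, f₂]

lemma IsSympBasis.exists_ap' {a b c d a' b' c' d' : V4 F} (h : IsSympBasis a b c d)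
    (h' : IsSympBasis a' b' c' d') : ∃ g : Sp4 F, ArcTransitive.ap g a = a' ∧
      ArcTransitive.ap g b = b' ∧ ArcTransitive.ap g c = c' ∧ ArcTransitive.ap g d = d' := by
  obtain ⟨g, rfl, rfl, rfl, rfl⟩ := h.exists_ap
  obtain ⟨g', rfl, rfl, rfl, rfl⟩ := h'.exists_ap
  exact ⟨g' * g⁻¹, by simp⟩

lemma IsSympBasis.eq_sum {a b c d : V4 F} (h : IsSympBasis a b c d) (x : V4 F) :
    x = B x c • a + B x d • b + B x a • c + B x b • d := by
  obtain ⟨g, rfl, rfl, rfl, rfl⟩ := h.exists_ap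
  obtain ⟨y, rfl⟩ : ∃ y, ArcTransitive.ap g y = x := ⟨_, ap_ap_inv g x⟩
  simp only [B_ap_ap, B_e₁, B_e₂, B_f₁, B_f₂, ← ap_smul, ← ap_add]
  rw [← eq_sum_std]

lemma exists_B_eq_one {v : V4 F} (hv : v ≠ 0) : ∃ x, B v x = 1 := by
  by_contra! H
  refine hv (eq_zero_of_B_right fun x ↦ ?_)
  by_contra hx
  exact H ((B v x)⁻¹ • x) (by rw [B_smul_right, inv_mul_cancel₀ (by rwa [B_comm])])

/-- The functional `B · v`. -/
def Bfun (v : V4 F) : V4 F →ₗ[F] F where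
  toFun x := B x v
  map_add' := by simp
  map_smul' := by simp

@[simp] lemma Bfun_apply (v x : V4 F) : Bfun v x = B x v := rfl

/-- Two linear conditions on a four-dimensional space leave a nonzero x orthogonal to v and w; a
partner of x is then corrected by its components along v and w. -/
lemma exists_isSympBasis_of_ne_zero {v w : V4 F} (h : B v w = 1) :
    ∃ x y, IsSympBasis v x w y := by
  obtain ⟨x, hx0, hx⟩ : ∃ x : V4 F, x ≠ 0 ∧ (B v x = 0 ∧ B w x = 0) := by
    have hlt : 0 < Module.finrank F (LinearMap.ker ((Bfun v).prod (Bfun w))) := by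
      have := LinearMap.finrank_range_add_finrank_ker ((Bfun v).prod (Bfun w))
      have h2 := Submodule.finrank_le (LinearMap.range ((Bfun v).prod (Bfun w)))
      simp at this h2
      omega
    obtain ⟨⟨x, hx⟩, hx0⟩ := Module.finrank_pos_iff_exists_ne_zero.1 hlt
    refine ⟨x, fun h ↦ hx0 (Subtype.ext h), ?_⟩
    simpa [B_comm x] using hx
  obtain ⟨y, hy⟩ := exists_B_eq_one hx0
  refine ⟨x, y + B y w • v + B y v • w, hx.1, h, ?_, by rw [B_comm, hx.2], ?_, ?_⟩
  · simp [B_self, h, B_comm v y]; grind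
  · simp [hy, B_comm x v, B_comm x w, hx.1, hx.2]
  · simp [B_self, B_comm w, h]; grind

end Form

/-! ### Transvections and the classes of involutions -/

section Transvections

open Matrix

variable {F : Type*} [Field F] [CharP F 2]

/-- The symplectic transvection `x ↦ x + B(x, v) v`. -/
def tv (v : V4 F) : Sp4 F :=
  ofIsometry (LinearMap.id + (Bfun v).smulRight v) fun x y ↦ by
    simp [B_self, B_comm v y]; grind

@[simp] lemma ap_tv (v x : V4 F) : ap (tv v) x = x + B x v • v := by simp [tv]

@[simp] lemma tv_zero : tv (0 : V4 F) = 1 := Sp4.ext_ap fun x ↦ by simp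

/-- Proportional vectors v = c w with the same transvection satisfy c² = 1, and in characteristic
two this forces c = 1. Thus an automorphism permuting transvections induces a map on vectors. -/
lemma tv_injective : Function.Injective (tv : V4 F → Sp4 F) := by
  intro v w h
  have H (x) : B x v • v = B x w • w := by
    have := congrArg (fun g ↦ ap g x) h
    simpa using this
  by_cases hv : v = 0
  · subst hv
    by_contra hw
    obtain ⟨x, hx⟩ := exists_B_eq_one (Ne.symm hw)
    have := H x
    rw [B_comm x w, hx] at this
    simp at this
    exact hw this
  · obtain ⟨x, hx⟩ := exists_B_eq_one hv
    have h1 := H x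
    rw [B_comm x v, hx, one_smul] at h1
    have hw : w ≠ 0 := by rintro rfl; simp at h1; exact hv h1
    obtain ⟨y, hy⟩ := exists_B_eq_one hw
    have h2 := H y
    generalize B x w = c at h1
    subst h1
    rw [B_smul_right, B_comm y w, hy, smul_smul] at h2
    have h3 := smul_left_injective F hw h2
    have : c = 1 := by
      have : (c - 1) * (c - 1) = 0 := by grind
      simpa [sub_eq_zero] using this
    rw [this, one_smul]

@[simp] lemma tv_inj {v w : V4 F} : tv v = tv w ↔ v = w := tv_injective.eq_iff

@[simp] lemma tv_mul_self (v : V4 F) : tv v * tv v = 1 := Sp4.ext_ap fun x ↦ by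
  apply V4.ext <;> simp [B_self] <;> grind

@[simp] lemma tv_inv (v : V4 F) : (tv v)⁻¹ = tv v := inv_eq_of_mul_eq_one_left (tv_mul_self v)

lemma conj_tv (s : Sp4 F) (v : V4 F) : s * tv v * s⁻¹ = tv (ap s v) := Sp4.ext_ap fun x ↦ by
  simp [B_ap_left s v, B_comm _ (ap s v), B_comm v]

lemma tv_mul_tv_mul_tv (v w : V4 F) : tv v * tv w * tv v = tv (w + B w v • v) := by
  have := conj_tv (tv v) w
  simpa using this

lemma commute_tv_iff {v w : V4 F} : Commute (tv v) (tv w) ↔ B v w = 0 := by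
  have : Commute (tv v) (tv w) ↔ tv v * tv w * (tv v)⁻¹ = tv w := by
    rw [commute_iff_eq, mul_inv_eq_iff_eq_mul]
  rw [this, conj_tv, ap_tv, tv_inj, B_comm]
  simp only [add_eq_left, smul_eq_zero, or_iff_left_iff_imp]
  rintro rfl
  simp

/-- Together with `commute_tv_iff`, this makes the form values 0 and 1 visible to the abstract
group, hence invariant under automorphisms that permute the transvections. -/
lemma braid_tv_iff {v w : V4 F} :
    tv v * tv w * tv v = tv w * tv v * tv w ↔ v = w ∨ B v w = 1 := by
  rw [tv_mul_tv_mul_tv, tv_mul_tv_mul_tv, tv_inj, B_comm w v]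
  constructor
  · intro h
    by_cases hc : B v w = 1
    · exact .inr hc
    · left
      have h1 : (1 - B v w) • (w - v) = 0 := by
        rw [sub_smul, one_smul, smul_sub, sub_sub_sub_eq, sub_eq_zero, ← h]
      rw [smul_eq_zero, sub_eq_zero, sub_eq_zero] at h1
      exact (h1.resolve_left (fun h ↦ hc h.symm)).symm
  · rintro (rfl | h)
    · rfl
    · rw [h, one_smul, one_smul, add_comm]

lemma tv_smul_mul_tv_smul (a b : F) (v : V4 F) : tv (a • v) * tv (b • v) = tv ((a + b) • v) :=
  Sp4.ext_ap fun x ↦ by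
  apply V4.ext <;> simp [B_self] <;> grind

/-- Short root involutions, with `B(x, g x) = 0` for all `x`. -/
def IsShort (g : Sp4 F) : Prop :=
  ∃ a b c d, IsSympBasis a b c d ∧ ∀ x, ap g x = x + B x a • b + B x b • a

/-- Involutions that are neither transvections nor short root involutions. -/
def IsMixed (g : Sp4 F) : Prop :=
  ∃ a b c d, IsSympBasis a b c d ∧ ∀ x, ap g x = x + B x a • b + B x b • a + B x a • a

lemma IsShort.isConj {g h : Sp4 F} (hg : IsShort g) (hh : IsShort h) : ∃ s, s * g * s⁻¹ = h := by
  obtain ⟨a, b, c, d, hb, H⟩ := hg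
  obtain ⟨a', b', c', d', hb', H'⟩ := hh
  obtain ⟨s, rfl, rfl, rfl, rfl⟩ := hb.exists_ap' hb'
  refine ⟨s, Sp4.ext_ap fun x ↦ ?_⟩
  simp [H, H', B_comm x, B_ap_left s, B_comm _ (ap s⁻¹ x)]

/-- Some product of two conjugates of a mixed involution has order four. -/
lemma IsMixed.exists_not_commute {g : Sp4 F} (hg : IsMixed g) :
    ∃ s, Commute g ((s * g * s⁻¹) * g * (s * g * s⁻¹)) ∧ ¬ Commute g (s * g * s⁻¹) := by
  obtain ⟨a, b, c, d, hb, H⟩ := hg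
  -- In characteristic two the form is symmetric, so a cyclic rotation of a symplectic basis is
  -- again one; s is this rotation.
  have hb' : IsSympBasis b c d a :=
    ⟨hb.bc, hb.bd, by rw [B_comm, hb.ab], hb.cd, by rw [B_comm, hb.ac], by rw [B_comm, hb.ad]⟩
  obtain ⟨s, h1, h2, h3, h4⟩ := hb.exists_ap' hb'
  have H' (x) : ap (s * g * s⁻¹) x = x + B x b • c + B x c • b + B x b • b := by
    simp [H, B_ap_left s⁻¹, h1, h2]
  refine ⟨s, ?_, ?_⟩
  · generalize s * g * s⁻¹ = t at H'
    refine Sp4.ext_ap fun x ↦ ?_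
    apply V4.ext <;> simp [H, H', B_self, hb.ab, hb.ac, hb.bc, B_comm b a,
      B_comm c a, B_comm c b] <;> grind
  · intro h
    generalize s * g * s⁻¹ = t at H' h
    have := congrArg (fun g ↦ B (ap g d) c) h.eq
    simp [H, H', B_self, hb.ab, hb.ac, hb.ad, hb.bc, hb.bd, hb.cd, B_comm b a,
      B_comm c a, B_comm d a, B_comm c b, B_comm d b, B_comm d c] at this

/-- The hypothesis says B(v, w)² = 0. Mixed involutions violate the analogous implication, so no
automorphism sends a transvection to one of them. -/
lemma commute_of_commute_tv {v w : V4 F} (h : Commute (tv v) (tv w * tv v * tv w)) :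
    Commute (tv v) (tv w) := by
  rw [tv_mul_tv_mul_tv, commute_tv_iff] at h
  simp [B_self] at h
  rwa [commute_tv_iff]


/-- An additive Frobenius-semilinear map to a perfect field is the square of a functional. -/
lemma exists_eq_B_sq [PerfectRing F 2] (q : V4 F → F) (hadd : ∀ x y, q (x + y) = q x + q y)
    (hsm : ∀ (c : F) x, q (c • x) = c ^ 2 * q x) : ∃ u, ∀ x, q x = B x u ^ 2 := by
  have hroot (c : F) : ∃ r, r ^ 2 = c := (frobeniusEquiv F 2).surjective c
  obtain ⟨r1, h1⟩ := hroot (q e₁)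
  obtain ⟨r2, h2⟩ := hroot (q e₂)
  obtain ⟨r3, h3⟩ := hroot (q f₁)
  obtain ⟨r4, h4⟩ := hroot (q f₂)
  refine ⟨r3 • e₁ + r4 • e₂ + r1 • f₁ + r2 • f₂, fun x ↦ ?_⟩
  conv_lhs => rw [eq_sum_std x]
  rw [hadd, hadd, hadd, hsm, hsm, hsm, hsm, ← h1, ← h2, ← h3, ← h4]
  simp only [B_add_right, B_smul_right, B_e₁, B_e₂, B_f₁, B_f₂]
  grind

/-- A nonzero alternating square-zero map has rank two. -/
lemma exists_isSympBasis_of_alternating (n : V4 F →ₗ[F] V4 F) (nalt : ∀ x, B x (n x) = 0)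
    (nn : ∀ x, n (n x) = 0) (hn : n ≠ 0) :
    ∃ a b c d, IsSympBasis a b c d ∧ ∀ x, n x = B x a • b + B x b • a := by
  have nsymm (x y) : B x (n y) = B y (n x) := by
    have := nalt (x + y)
    simp only [map_add, B_add_left, B_add_right, nalt] at this
    grind
  obtain ⟨x₀, hx₀⟩ : ∃ x, n x ≠ 0 := by
    by_contra! H
    exact hn (LinearMap.ext H)
  obtain ⟨y₀, hy₀⟩ := exists_B_eq_one hx₀
  rw [B_comm, nsymm] at hy₀
  have hb : IsSympBasis (n y₀) (n x₀) x₀ (y₀ + B x₀ y₀ • n y₀) := by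
    constructor
    · rw [nsymm, nn, B_zero_right]
    · rw [B_comm, hy₀]
    · simp [B_self, B_comm _ y₀, nalt]
    · rw [B_comm, nalt]
    · have : B (n x₀) (n y₀) = 0 := by rw [nsymm, nn, B_zero_right]
      rw [B_add_right, B_smul_right, this, B_comm, nsymm, hy₀]
      simp
    · simp [hy₀]; grind
  refine ⟨_, _, _, _, hb, fun x ↦ ?_⟩
  conv_lhs => rw [hb.eq_sum x]
  simp [nn]

/-- The involutions of `Sp₄(F)`, for `F` perfect of characteristic two. -/
lemma involution_cases [PerfectRing F 2] {g : Sp4 F} (hg : g * g = 1) :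
    (∃ v, g = tv v) ∨ IsShort g ∨ IsMixed g := by
  have hgg (x) : ap g (ap g x) = x := by rw [← ap_mul, hg, ap_one]
  have hB (x y) : B (ap g x) y = B x (ap g y) := by
    rw [B_ap_left, inv_eq_of_mul_eq_one_left hg]
  -- An involution is self-adjoint, so the cross terms of B(x, g x) cancel and this quadratic
  -- expression is additive. Removing B(x, u) u from g − 1 then leaves an alternating square-zero
  -- map n.
  obtain ⟨u, hu⟩ : ∃ u, ∀ x, B x (ap g x) = B x u ^ 2 := by
    refine exists_eq_B_sq _ (fun x y ↦ ?_) fun c x ↦ ?_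
    · simp only [ap_add, B_add_left, B_add_right, ← hB y x, B_comm (ap g y) x]; grind
    · simp only [ap_smul, B_smul_left, B_smul_right]; ring
  have hgu : ap g u = u := by
    refine eq_of_B_right fun x ↦ ?_
    have h1 := hu (ap g x)
    rw [hgg, B_comm, hu, hB] at h1
    have : (B x u - B x (ap g u)) * (B x u - B x (ap g u)) = 0 := by grind
    rw [mul_self_eq_zero, sub_eq_zero] at this
    exact this.symm
  let n : V4 F →ₗ[F] V4 F :=
    { toFun x := ap g x + x + B x u • u
      map_add' x y := by
        simp only [ap_add, B_add_left, add_smul]; abel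
      map_smul' c x := by
        simp only [ap_smul, B_smul_left, mul_smul, smul_add, RingHom.id_apply] }
  have n_def (x) : n x = ap g x + x + B x u • u := rfl
  clear_value n
  have hg' (x) : ap g x = n x + x + B x u • u := by
    rw [n_def]
    apply V4.ext <;> simp only [Pi.add_apply, Pi.smul_apply, smul_eq_mul] <;> grind
  have nalt (x) : B x (n x) = 0 := by
    simp only [n_def, B_add_right, hu, B_self, B_smul_right]; grind
  have nu : n u = 0 := by
    rw [n_def, hgu, B_self]
    apply V4.ext <;> simp only [Pi.add_apply, Pi.smul_apply, smul_eq_mul, Pi.zero_apply] <;> grind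
  have nn (x) : n (n x) = 0 := by
    have h1 : n (ap g x) = n x := by
      rw [n_def, n_def, hgg, hB, hgu, add_comm x]
    rw [n_def x, map_add, map_add, map_smul, nu, h1, smul_zero, add_zero]
    exact funext fun i ↦ CharTwo.add_self_eq_zero _
  by_cases hn : n = 0
  · exact .inl ⟨u, Sp4.ext_ap fun x ↦ by simp [hg', hn]⟩
  right
  obtain ⟨v, w, x₀, z₀, hb, hn⟩ := exists_isSympBasis_of_alternating n nalt nn hn
  have h1 := hn u
  rw [nu] at h1
  have huw := congrArg (fun z ↦ B x₀ z) h1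
  have huv := congrArg (fun z ↦ B z₀ z) h1
  simp only [B_zero_right, B_add_right, B_smul_right, B_comm x₀ w, B_comm x₀ v, hb.bc, hb.ac,
    mul_zero, mul_one, zero_add] at huw
  simp only [B_zero_right, B_add_right, B_smul_right, B_comm z₀ w, B_comm z₀ v, hb.bd, hb.ad,
    mul_zero, mul_one, add_zero] at huv
  have hu' := hb.eq_sum u
  rw [← huv, ← huw, zero_smul, zero_smul, add_zero, add_zero] at hu'
  generalize B u x₀ = p at hu'
  generalize B u z₀ = r at hu'
  -- Because n u = 0, u lies in the span of v and w. If u = 0 then g is short; otherwise u becomes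
  -- the first vector of an adapted basis and B(x, u) u is the extra term of a mixed involution.
  by_cases hp : p = 0
  · by_cases hr : r = 0
    · left
      refine ⟨_, _, _, _, hb, fun x ↦ ?_⟩
      rw [hg', hn, hu', hp, hr]
      simp only [zero_smul, add_zero, B_zero_right]
      abel
    · right
      refine ⟨r • w, r⁻¹ • v, r⁻¹ • z₀, r • x₀, ?_, fun x ↦ ?_⟩
      · constructor <;> simp [B_comm w v, hb.ab, hb.ac, hb.ad, hb.bc, hb.bd, hb.cd, B_comm z₀ x₀, hr]
      · rw [hg', hn, hu', hp, zero_smul, zero_add]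
        apply V4.ext <;>
          simp only [Pi.add_apply, Pi.smul_apply, smul_eq_mul, B_smul_right] <;> field_simp <;> ring
  · right
    refine ⟨u, p⁻¹ • w, p⁻¹ • x₀, p • z₀ + r • x₀, ?_, fun x ↦ ?_⟩
    · rw [hu']
      constructor <;> simp [hb.ab, hb.ac, hb.ad, hb.bc, hb.bd, hb.cd, B_self, hp]
      grind
    · rw [hg', hn, hu']
      funext i
      simp only [Pi.add_apply, Pi.smul_apply, smul_eq_mul, B_smul_right, B_add_right]
      linear_combination (-(B x v * w i) - B x w * v i) * mul_inv_cancel₀ hp -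
        p⁻¹ * r * B x w * w i * CharTwo.two_eq_zero (R := F)

end Transvections

/-! ### Automorphisms of Sp₄(2ⁿ) and the index of the socle -/

section Automorphisms

open Matrix

variable {F : Type*} [Field F] [CharP F 2]

lemma exists_ap_eq_of_ne_zero {v w : V4 F} (hv : v ≠ 0) (hw : w ≠ 0) : ∃ s : Sp4 F, ap s v = w := by
  obtain ⟨v', hv'⟩ := exists_B_eq_one hv
  obtain ⟨w', hw'⟩ := exists_B_eq_one hw
  obtain ⟨_, _, h1⟩ := exists_isSympBasis_of_ne_zero hv'
  obtain ⟨_, _, h2⟩ := exists_isSympBasis_of_ne_zero hw'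
  obtain ⟨s, hs, -⟩ := h1.exists_ap' h2
  exact ⟨s, hs⟩

lemma e₁_ne_zero : (e₁ : V4 F) ≠ 0 := by simp [e₁]

/-- The automorphism `α` preserves the class of transvections. -/
def PreservesTv (α : MulAut (Sp4 F)) : Prop := ∀ v, ∃ w, α (tv v) = tv w

lemma preservesTv_one : PreservesTv (1 : MulAut (Sp4 F)) := fun v ↦ ⟨v, rfl⟩

lemma PreservesTv.mul {α β : MulAut (Sp4 F)} (hα : PreservesTv α) (hβ : PreservesTv β) :
    PreservesTv (α * β) := fun v ↦ by
  obtain ⟨w, hw⟩ := hβ v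
  obtain ⟨u, hu⟩ := hα w
  exact ⟨u, by rw [MulAut.mul_apply, hw, hu]⟩

lemma preservesTv_of_conj {α : MulAut (Sp4 F)} {s : Sp4 F} (h : ∀ x, α x = s * x * s⁻¹) :
    PreservesTv α := fun v ↦ ⟨_, by rw [h, conj_tv]⟩

/-- Nontrivial transvections form one conjugacy class, so a single image decides. -/
lemma preservesTv_of_exists {α : MulAut (Sp4 F)} {v₀ w₀ : V4 F} (hv₀ : v₀ ≠ 0)
    (h : α (tv v₀) = tv w₀) : PreservesTv α := fun v ↦ by
  by_cases hv : v = 0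
  · exact ⟨0, by simp [hv]⟩
  · obtain ⟨s, rfl⟩ := exists_ap_eq_of_ne_zero hv₀ hv
    exact ⟨ap (α s) w₀, by rw [← conj_tv s v₀, map_mul, map_mul, map_inv, h, conj_tv]⟩

lemma not_isMixed_map_tv (α : MulAut (Sp4 F)) (v : V4 F) : ¬ IsMixed (α (tv v)) := fun h ↦ by
  obtain ⟨s, h1, h2⟩ := h.exists_not_commute
  obtain ⟨t, rfl⟩ := α.surjective s
  rw [← map_inv, ← map_mul, ← map_mul, conj_tv] at h1 h2
  rw [← map_mul, ← map_mul] at h1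
  have hcomm {x y : Sp4 F} : Commute (α x) (α y) ↔ Commute x y :=
    ⟨fun h ↦ α.injective (by simpa using h.eq), fun h ↦ h.map α⟩
  rw [hcomm] at h1 h2
  exact h2 (commute_of_commute_tv h1)

lemma B_eq_zero_iff_of_map_tv {α : MulAut (Sp4 F)} {v w v' w' : V4 F} (hv : α (tv v) = tv v')
    (hw : α (tv w) = tv w') : B v w = 0 ↔ B v' w' = 0 := by
  rw [← commute_tv_iff, ← commute_tv_iff, ← hv, ← hw]
  exact ⟨fun h ↦ h.map α, fun h ↦ α.injective (by simpa using h.eq)⟩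

lemma B_eq_one_iff_of_map_tv {α : MulAut (Sp4 F)} {v w v' w' : V4 F} (hv : α (tv v) = tv v')
    (hw : α (tv w) = tv w') : B v w = 1 ↔ B v' w' = 1 := by
  by_cases hvw : v = w
  · subst hvw
    rw [hv, tv_inj] at hw
    simp [hw, B_self]
  · have hvw' : v' ≠ w' := by
      rintro rfl
      exact hvw (tv_injective (α.injective (hv.trans hw.symm)))
    have := braid_tv_iff (v := v') (w := w')
    rw [← hv, ← hw, ← map_mul, ← map_mul, ← map_mul, ← map_mul, α.injective.eq_iff,
      braid_tv_iff] at this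
    simpa [hvw, hvw'] using this

lemma Sp4.eq_one_of_ap {g : Sp4 F} (h₁ : ap g e₁ = e₁) (h₂ : ap g e₂ = e₂) (h₃ : ap g f₁ = f₁)
    (h₄ : ap g f₂ = f₂) : g = 1 := Sp4.ext_ap fun x ↦ by
  rw [eq_sum_std x]
  simp only [ap_add, ap_smul, h₁, h₂, h₃, h₄, ap_one]

variable [Finite F]

lemma PreservesTv.inv {α : MulAut (Sp4 F)} (hα : PreservesTv α) : PreservesTv α⁻¹ := by
  choose π hπ using hα
  have hinj : Function.Injective π := fun v w h ↦ by
    apply tv_injective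
    apply α.injective
    rw [hπ, hπ, h]
  intro v
  obtain ⟨w, rfl⟩ := (Finite.injective_iff_surjective.1 hinj) v
  exact ⟨w, by rw [← hπ, MulAut.inv_apply_self]⟩

lemma isShort_map_tv {α : MulAut (Sp4 F)} (hα : ¬ PreservesTv α) {v : V4 F} (hv : v ≠ 0) :
    IsShort (α (tv v)) := by
  rcases involution_cases (g := α (tv v)) (by rw [← map_mul, tv_mul_self, map_one]) with h | h | h
  · obtain ⟨w, hw⟩ := h
    exact absurd (preservesTv_of_exists hv hw) hα
  · exact h
  · exact absurd h (not_isMixed_map_tv α v)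

/-- Both automorphisms send a transvection into the single class of short root involutions. This is
what bounds the index of the transvection-preserving subgroup by two. -/
lemma preservesTv_inv_mul {α β : MulAut (Sp4 F)} (hα : ¬ PreservesTv α) (hβ : ¬ PreservesTv β) :
    PreservesTv (α⁻¹ * β) := by
  obtain ⟨s, hs⟩ := (isShort_map_tv hα e₁_ne_zero).isConj (isShort_map_tv hβ e₁_ne_zero)
  refine preservesTv_of_exists (v₀ := e₁) (w₀ := ap (α⁻¹ s) e₁) e₁_ne_zero ?_
  rw [MulAut.mul_apply, ← hs, map_mul, map_mul, MulAut.inv_apply_self, map_inv, conj_tv]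

/-- An automorphism preserving the transvections and fixing those of a symplectic basis is a
field automorphism. -/
lemma PreservesTv.exists_ringEquiv {α : MulAut (Sp4 F)} (hα : PreservesTv α)
    (he₁ : α (tv e₁) = tv e₁) (he₂ : α (tv e₂) = tv e₂) (hf₁ : α (tv f₁) = tv f₁)
    (hf₂ : α (tv f₂) = tv f₂) : ∃ σ : F ≃+* F, ∀ v, α (tv v) = tv (σ ∘ v) := by
  choose π hπ using hα
  have h0 (v w) : B v w = 0 ↔ B (π v) (π w) = 0 := B_eq_zero_iff_of_map_tv (hπ v) (hπ w)
  have h1 (v w) : B v w = 1 ↔ B (π v) (π w) = 1 := B_eq_one_iff_of_map_tv (hπ v) (hπ w)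
  have pe₁ : π e₁ = e₁ := tv_injective (by rw [← hπ, he₁])
  have pe₂ : π e₂ = e₂ := tv_injective (by rw [← hπ, he₂])
  have pf₁ : π f₁ = f₁ := tv_injective (by rw [← hπ, hf₁])
  have pf₂ : π f₂ = f₂ := tv_injective (by rw [← hπ, hf₂])
  have std := isSympBasis_std (F := F)
  -- the images of the coordinate axes
  have axis {b b' c d : V4 F} (hB : IsSympBasis b c b' d) (pb : π b = b) (pc : π c = c)
      (pd : π d = d) (a : F) : π (a • b) = B (π (a • b)) b' • b := by
    have hb := (h0 (a • b) b).1 (by simp [B_self])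
    have hc := (h0 (a • b) c).1 (by simp [hB.ab])
    have hd := (h0 (a • b) d).1 (by simp [hB.ad])
    rw [pb] at hb
    rw [pc] at hc
    rw [pd] at hd
    conv_lhs => rw [hB.eq_sum (π (a • b)), hb, hc, hd]
    simp
  have std' : IsSympBasis (f₁ : V4 F) f₂ e₁ e₂ := by
    constructor <;> simp <;> simp [e₁, f₁, f₂]
  have std₂ : IsSympBasis (e₂ : V4 F) e₁ f₂ f₁ := by
    constructor <;> simp <;> simp [e₁, e₂, f₂]
  have std₂' : IsSympBasis (f₂ : V4 F) f₁ e₂ e₁ := by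
    constructor <;> simp <;> simp [e₂, f₁, f₂]
  have axis_e₁ := axis std pe₁ pe₂ pf₂
  have axis_f₁ := axis std' pf₁ pf₂ pe₂
  have axis_e₂ := axis std₂ pe₂ pe₁ pf₁
  have axis_f₂ := axis std₂' pf₂ pf₁ pe₁
  -- the images of vectors, by coordinates
  have coord {b b' : V4 F} (pb' : π b' = b') (hb : B b b' = 1)
      (ax : ∀ a : F, π (a • b) = B (π (a • b)) b' • b)
      (ax' : ∀ a : F, π (a • b') = B (π (a • b')) b • b') (x : V4 F) :
      B (π x) b' = B (π (B x b' • b)) b' := by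
    by_cases hx : B x b' = 0
    · have h3 := (h0 x b').1 hx
      rw [pb'] at h3
      have h4 := (h0 (B x b' • b) b').1 (by simp [hx])
      rw [pb'] at h4
      rw [h3, h4]
    -- Only the values 0 and 1 of the form are known to be preserved, so a nonzero coordinate is
    -- normalised to 1 by rescaling b'.
    · have h3 := (h1 x ((B x b')⁻¹ • b')).1 (by simp [hx])
      have h4 := (h1 (B x b' • b) ((B x b')⁻¹ • b')).1 (by simp [hx, hb])
      rw [ax', B_smul_right] at h3 h4
      exact mul_left_cancel₀ (left_ne_zero_of_mul_eq_one h3) (h3.trans h4.symm)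
  have coord_e₁ := coord pf₁ std.ac axis_e₁ axis_f₁
  have coord_f₁ := coord pe₁ std'.ac axis_f₁ axis_e₁
  have coord_e₂ := coord pf₂ std₂.ac axis_e₂ axis_f₂
  have coord_f₂ := coord pe₂ std₂'.ac axis_f₂ axis_e₂
  obtain ⟨σ, hσ⟩ : ∃ σ : F → F, ∀ a, σ a = B (π (a • e₁)) f₁ := ⟨_, fun _ ↦ rfl⟩
  obtain ⟨τ, hτ⟩ : ∃ τ : F → F, ∀ a, τ a = B (π (a • f₁)) e₁ := ⟨_, fun _ ↦ rfl⟩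
  obtain ⟨σ', hσ'⟩ : ∃ σ' : F → F, ∀ a, σ' a = B (π (a • e₂)) f₂ := ⟨_, fun _ ↦ rfl⟩
  obtain ⟨τ', hτ'⟩ : ∃ τ' : F → F, ∀ a, τ' a = B (π (a • f₂)) e₂ := ⟨_, fun _ ↦ rfl⟩
  have σ1 : σ 1 = 1 := by rw [hσ, one_smul, pe₁, std.ac]
  have τ1 : τ 1 = 1 := by rw [hτ, one_smul, pf₁, std'.ac]
  have σ'1 : σ' 1 = 1 := by rw [hσ', one_smul, pe₂, std₂.ac]
  have τ'1 : τ' 1 = 1 := by rw [hτ', one_smul, pf₂, std₂'.ac]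
  simp only [← hσ, ← hτ, ← hσ', ← hτ', B_e₁, B_e₂, B_f₁, B_f₂]
    at coord_e₁ coord_e₂ coord_f₁ coord_f₂
  have key (x y) : B x y = 0 ↔ σ (x (.inl 0)) * τ (y (.inr 0)) + σ' (x (.inl 1)) * τ' (y (.inr 1))
      + τ (x (.inr 0)) * σ (y (.inl 0)) + τ' (x (.inr 1)) * σ' (y (.inl 1)) = 0 := by
    rw [h0, B, coord_e₁, coord_e₂, coord_f₁, coord_f₂, coord_e₁, coord_e₂, coord_f₁, coord_f₂]
  have π0 : π 0 = 0 := tv_injective (by rw [← hπ, tv_zero, map_one])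
  have σ0 : σ 0 = 0 := by rw [hσ, zero_smul, π0, B_zero_left]
  have τ0 : τ 0 = 0 := by rw [hτ, zero_smul, π0, B_zero_left]
  have σ'0 : σ' 0 = 0 := by rw [hσ', zero_smul, π0, B_zero_left]
  have τ'0 : τ' 0 = 0 := by rw [hτ', zero_smul, π0, B_zero_left]
  have hne (a : F) : a + a = 0 := CharTwo.add_self_eq_zero a
  -- Orthogonal pairs such as (a, 1), (1, a) identify the four coordinate maps with one another; the
  -- pair (a, 1), (b, ab) makes the common map multiplicative. Additivity comes instead from
  -- multiplying transvections along one line.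
  have key₁ (a b c d : F) : a * c + b * d = 0 ↔ σ a * τ c + σ' b * τ' d = 0 := by
    simpa [B, σ0, τ0, σ'0, τ'0] using key (Sum.elim ![a, b] ![0, 0]) (Sum.elim ![0, 0] ![c, d])
  have key₂ (a b c d : F) : a * c + b * d = 0 ↔ σ a * τ c + τ' b * σ' d = 0 := by
    simpa [B, σ0, τ0, σ'0, τ'0] using key (Sum.elim ![a, 0] ![0, b]) (Sum.elim ![0, d] ![c, 0])
  have hτ'σ (a) : τ' a = σ a := by
    have := (key₁ a 1 1 a).1 (by simp [hne])
    rw [τ1, σ'1, mul_one, one_mul, CharTwo.add_eq_zero] at this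
    exact this.symm
  have hσ'σ (a) : σ' a = σ a := by
    have := (key₂ a 1 1 a).1 (by simp [hne])
    rw [τ1, τ'1, mul_one, one_mul, CharTwo.add_eq_zero] at this
    exact this.symm
  have hτσ (a) : τ a = σ a := by
    have := (key₁ 1 a a 1).1 (by simp [hne])
    rw [σ1, τ'1, mul_one, one_mul, CharTwo.add_eq_zero] at this
    rw [this, hσ'σ]
  have hmul (a b) : σ (a * b) = σ a * σ b := by
    have := (key₁ a 1 b (a * b)).1 (by simp [hne])
    rw [σ'1, one_mul, CharTwo.add_eq_zero, hτσ, hτ'σ] at this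
    exact this.symm
  have hadd (a b) : σ (a + b) = σ a + σ b := by
    have h2 : π ((a + b) • e₁) = (σ a + σ b) • e₁ := by
      apply tv_injective
      rw [← hπ, ← tv_smul_mul_tv_smul, ← tv_smul_mul_tv_smul, map_mul, hπ, hπ, hσ, hσ, ← axis_e₁,
        ← axis_e₁]
    rw [hσ, h2, B_smul_left, std.ac, mul_one]
  let σr : F →+* F := ⟨⟨⟨σ, σ1⟩, hmul⟩, σ0, hadd⟩
  refine ⟨RingEquiv.ofBijective σr (Finite.injective_iff_bijective.1 σr.injective), fun v ↦ ?_⟩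
  rw [hπ, tv_inj]
  apply V4.ext
  · exact coord_e₁ v
  · exact (coord_e₂ v).trans (hσ'σ _)
  · exact (coord_f₁ v).trans (hτσ _)
  · exact (coord_f₂ v).trans (hτ'σ _)

/-- Since s t_v s⁻¹ is the transvection of s v, an automorphism fixing all transvections cannot
change how s acts on vectors. -/
lemma eq_one_of_map_tv {α : MulAut (Sp4 F)} (hα : ∀ v, α (tv v) = tv v) : α = 1 := by
  ext1 s
  refine Sp4.ext_ap fun v ↦ tv_injective ?_
  have := hα (ap s v)
  rw [← conj_tv, map_mul, map_mul, map_inv, hα, conj_tv, conj_tv] at this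
  exact this

/-- Field automorphisms fix the prime field, so their number is at most the degree over it. -/
lemma card_ringEquiv_le {n : ℕ} (hn : Nat.card F = 2 ^ n) : Nat.card (F ≃+* F) ≤ n := by
  let := ZMod.algebra F 2
  have h1 : Module.finrank (ZMod 2) F = n := by
    have := Module.natCard_eq_pow_finrank (K := ZMod 2) (V := F)
    rw [hn, Nat.card_zmod] at this
    exact (Nat.pow_right_injective le_rfl this).symm
  let f : (F ≃+* F) → (F ≃ₐ[ZMod 2] F) := fun σ ↦ AlgEquiv.ofRingEquiv (f := σ) fun x ↦
    RingHom.congr_fun (Subsingleton.elim ((σ : F →+* F).comp (algebraMap (ZMod 2) F))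
      (algebraMap (ZMod 2) F)) x
  have hf : Function.Injective f := fun σ τ h ↦ RingEquiv.ext fun x ↦ DFunLike.congr_fun h x
  have := Nat.card_le_card_of_injective f hf
  have h2 := AlgEquiv.card_le (F := ZMod 2) (K := F)
  rw [h1, ← Nat.card_eq_fintype_card] at h2
  exact this.trans h2

/-- The outer automorphism group of `Sp₄(2ⁿ)` is small. -/
lemma exists_index_range_eq {G : Type*} [Group G] [Finite G] {i : Sp4 F →* G}
    (φ : G →* MulAut (Sp4 F)) (hφ : Function.Injective φ)
    (hi : Function.Injective i) (h : ∀ s x, φ (i s) x = s * x * s⁻¹) {n : ℕ}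
    (hn : Nat.card F = 2 ^ n) :
    ∃ j k, (j = 1 ∨ j = 2) ∧ k ≤ n ∧ i.range.index = j * k := by
  let G₀ : Subgroup G :=
    { carrier := {g | PreservesTv (φ g)}
      one_mem' := by simpa using preservesTv_one
      mul_mem' := fun ha hb ↦ by simpa using PreservesTv.mul ha hb
      inv_mem' := fun ha ↦ by simpa using PreservesTv.inv ha }
  let K := {g : G // PreservesTv (φ g) ∧ φ g (tv e₁) = tv e₁ ∧ φ g (tv e₂) = tv e₂ ∧
    φ g (tv f₁) = tv f₁ ∧ φ g (tv f₂) = tv f₂}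
  have hj : G₀.index = 1 ∨ G₀.index = 2 := by
    by_cases hG : G₀ = ⊤
    · left; rw [hG, Subgroup.index_top]
    · right
      rw [Subgroup.index_eq_two_iff]
      obtain ⟨a, ha⟩ : ∃ a, a ∉ G₀ := by
        by_contra! H
        exact hG (eq_top_iff.2 fun g _ ↦ H g)
      refine ⟨a, fun b ↦ ?_⟩
      by_cases hb : b ∈ G₀
      · exact .inr ⟨hb, fun h ↦ ha ((Subgroup.mul_mem_cancel_left _ hb).1 h)⟩
      · refine .inl ⟨?_, hb⟩
        have hb' : b⁻¹ ∉ G₀ := fun h ↦ hb (inv_mem_iff.1 h)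
        have := preservesTv_inv_mul (α := φ b⁻¹) (β := φ a) hb' ha
        rw [← map_inv, ← map_mul, inv_inv] at this
        exact this
  have hK : Nat.card K ≤ n := by
    refine le_trans ?_ (card_ringEquiv_le hn)
    have : Finite (F ≃+* F) := Finite.of_injective _ (DFunLike.coe_injective (F := F ≃+* F))
    choose σ hσ using fun k : K ↦ k.2.1.exists_ringEquiv k.2.2.1 k.2.2.2.1 k.2.2.2.2.1 k.2.2.2.2.2
    refine Nat.card_le_card_of_injective σ fun k l hkl ↦ Subtype.ext (hφ ?_)
    rw [← inv_mul_eq_one]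
    refine eq_one_of_map_tv fun v ↦ ?_
    rw [MulAut.mul_apply, hσ, ← hkl, ← hσ, MulAut.inv_apply_self]
  -- Unique factorisation G₀ = S·K: the image of the standard basis under the induced map on vectors
  -- is again symplectic, and exactly one element of S realises it. Only the cardinality of K is
  -- needed, not a group structure.
  have hcard : Nat.card G₀ = Nat.card (Sp4 F) * Nat.card K := by
    rw [← Nat.card_prod]
    symm
    refine Nat.card_congr (Equiv.ofBijective
      (fun p : Sp4 F × K ↦ (⟨i p.1 * p.2, mul_mem ?_ p.2.2.1⟩ : G₀)) ⟨?_, ?_⟩)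
    · exact preservesTv_of_conj (h p.1)
    · rintro ⟨s, k⟩ ⟨t, l⟩ hst
      have hst : i s * k = i t * l := congrArg Subtype.val hst
      have fix {v : V4 F} (hk : φ k (tv v) = tv v) (hl : φ l (tv v) = tv v) :
          ap (t⁻¹ * s) v = v := by
        have := congrArg (fun g ↦ φ g (tv v)) hst
        simp only [map_mul, MulAut.mul_apply, hk, hl, h, conj_tv, tv_inj] at this
        rw [ap_mul, this, ap_inv_ap]
      have hs := Sp4.eq_one_of_ap (fix k.2.2.1 l.2.2.1) (fix k.2.2.2.1 l.2.2.2.1)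
        (fix k.2.2.2.2.1 l.2.2.2.2.1) (fix k.2.2.2.2.2 l.2.2.2.2.2)
      obtain rfl := inv_mul_eq_one.1 hs
      rw [mul_left_cancel_iff, Subtype.val_inj] at hst
      rw [hst]
    · rintro ⟨g, hg⟩
      choose π hπ using id hg
      have h0 (v w) : B v w = 0 ↔ B (π v) (π w) = 0 := B_eq_zero_iff_of_map_tv (hπ v) (hπ w)
      have h1 (v w) : B v w = 1 ↔ B (π v) (π w) = 1 := B_eq_one_iff_of_map_tv (hπ v) (hπ w)
      have std := isSympBasis_std (F := F)
      obtain ⟨s, h₁, h₂, h₃, h₄⟩ := IsSympBasis.exists_ap (a := π e₁) (b := π e₂) (c := π f₁)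
        (d := π f₂) ⟨(h0 _ _).1 std.ab, (h1 _ _).1 std.ac, (h0 _ _).1 std.ad, (h0 _ _).1 std.bc,
          (h1 _ _).1 std.bd, (h0 _ _).1 std.cd⟩
      have fix {v : V4 F} (hv : ap s v = π v) : φ (i s⁻¹ * g) (tv v) = tv v := by
        rw [map_mul, MulAut.mul_apply, hπ, h, conj_tv, ← hv, ap_inv_ap]
      refine ⟨⟨s, ⟨i s⁻¹ * g, ?_, fix h₁, fix h₂, fix h₃, fix h₄⟩⟩, Subtype.ext ?_⟩
      · rw [map_mul]
        exact (preservesTv_of_conj (h _)).mul fun v ↦ ⟨_, hπ v⟩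
      · simp
  refine ⟨G₀.index, Nat.card K, hj, hK, ?_⟩
  have h1 := G₀.card_mul_index
  have h2 := i.range.card_mul_index
  rw [← h1, hcard, ← Nat.card_congr (MonoidHom.ofInjective hi).toEquiv, mul_assoc] at h2
  rw [Nat.eq_of_mul_eq_mul_left Nat.card_pos h2, mul_comm]

end Automorphisms

/-! ### Subgroups of C_m × C_m without full p-torsion -/

section CyclicProduct

/-- The a-th power map sends the ab-torsion into the b-torsion, with kernel inside the a-torsion. -/
lemma card_ker_powMonoidHom_mul_le {D : Type*} [CommGroup D] [Finite D] (a b : ℕ) :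
    Nat.card (powMonoidHom (a * b) : D →* D).ker ≤
      Nat.card (powMonoidHom a : D →* D).ker * Nat.card (powMonoidHom b : D →* D).ker := by
  set E := (powMonoidHom (a * b) : D →* D).ker
  let φ : E →* D := (powMonoidHom a).comp E.subtype
  rw [← φ.ker.card_mul_index, Subgroup.index_ker]
  refine Nat.mul_le_mul ?_ ?_
  · exact Nat.card_le_card_of_injective
      (fun x : φ.ker ↦ (⟨x.1.1, x.2⟩ : (powMonoidHom a : D →* D).ker)) fun x y h ↦ by
        exact Subtype.ext <| Subtype.ext (congrArg (fun z : (powMonoidHom a : D →* D).ker ↦ z.1) h)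
  · refine Subgroup.card_le_of_le ?_
    rintro _ ⟨⟨x, hx⟩, rfl⟩
    have hx : x ^ (a * b) = 1 := hx
    rw [pow_mul] at hx
    exact hx

lemma card_ker_powMonoidHom {D : Type*} [CommGroup D] [Fintype D] [DecidableEq D] (n : ℕ) :
    Nat.card (powMonoidHom n : D →* D).ker = (Finset.univ.filter fun x : D ↦ x ^ n = 1).card :=
  Nat.subtype_card _ (by simp [MonoidHom.mem_ker])

lemma IsCyclic.card_ker_powMonoidHom_le {D : Type*} [CommGroup D] [Finite D] [IsCyclic D] {n : ℕ}
    (hn : 0 < n) : Nat.card (powMonoidHom n : D →* D).ker ≤ n := by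
  classical
  have := Fintype.ofFinite D
  rw [card_ker_powMonoidHom]
  exact IsCyclic.card_pow_eq_one_le hn

/-- A subgroup of a product of two cyclic groups of order `m` that contains none of the full
`p`-torsion subgroups has order dividing `m`. -/
lemma card_dvd_of_forall_torsion {A C : Type*} [CommGroup A] [CommGroup C] [IsCyclic A]
    [IsCyclic C] {m : ℕ} (hm : 0 < m) (hA : Nat.card A = m) (hC : Nat.card C = m)
    (D : Subgroup (A × C))
    (h : ∀ p, p.Prime → p ∣ m → ∃ x : A × C, x ^ p = 1 ∧ x ∉ D) : Nat.card D ∣ m := by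
  have : Finite A := Nat.finite_of_card_ne_zero (by omega)
  have : Finite C := Nat.finite_of_card_ne_zero (by omega)
  have hexp (x : A × C) : x ^ m = 1 := by
    ext
    · rw [Prod.pow_fst, ← hA, pow_card_eq_one']; rfl
    · rw [Prod.pow_snd, ← hC, pow_card_eq_one']; rfl
  -- For p ∣ m the p-torsion of D is a p-group properly contained in a group of order at most p², so
  -- it has order at most p. Multiplicativity extends the bound to every n, which is the criterion
  -- for D to be cyclic.
  have hp (p : ℕ) (hp : p.Prime) : Nat.card (powMonoidHom p : D →* D).ker ≤ p := by
    by_cases hpm : p ∣ m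
    · obtain ⟨x, hx, hxD⟩ := h p hp hpm
      set T := (powMonoidHom p : D →* D).ker
      set P := (powMonoidHom p : A × C →* A × C).ker
      have hlt : Nat.card T < Nat.card P := by
        have hP : Nat.card T = Nat.card (T.map D.subtype) :=
          Nat.card_congr (T.equivMapOfInjective _ D.subtype_injective).toEquiv
        have hle : T.map D.subtype ≤ P := by
          rintro _ ⟨y, hy, rfl⟩
          have : y ^ p = 1 := hy
          simpa [P, MonoidHom.mem_ker, Subtype.ext_iff] using this
        rw [hP]
        refine lt_of_le_of_ne (Subgroup.card_le_of_le hle) fun heq ↦ hxD ?_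
        have := Subgroup.eq_of_le_of_card_ge hle heq.ge
        have hxP : x ∈ P := hx
        rw [← this] at hxP
        obtain ⟨y, -, rfl⟩ := hxP
        exact y.2
      have hP : Nat.card P ≤ p * p := by
        refine le_trans ?_ (Nat.mul_le_mul
          (IsCyclic.card_ker_powMonoidHom_le (D := A) hp.pos)
          (IsCyclic.card_ker_powMonoidHom_le (D := C) hp.pos))
        rw [← Nat.card_prod]
        refine Nat.card_le_card_of_injective (fun x : P ↦
          (⟨x.1.1, congrArg Prod.fst x.2⟩, ⟨x.1.2, congrArg Prod.snd x.2⟩)) fun x y hxy ↦ ?_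
        rw [Prod.mk.injEq] at hxy
        exact Subtype.ext (Prod.ext (congrArg Subtype.val hxy.1) (congrArg Subtype.val hxy.2))
      have hT : IsPGroup p T := fun y ↦ ⟨1, by
        have := y.2
        rw [pow_one]
        exact Subtype.ext this⟩
      have := Fact.mk hp
      obtain ⟨k, hk⟩ := IsPGroup.iff_card.1 hT
      rw [hk] at hlt ⊢
      have hk2 : p ^ k < p ^ 2 := by nlinarith
      have := (Nat.pow_lt_pow_iff_right hp.one_lt).1 hk2
      calc p ^ k ≤ p ^ 1 := Nat.pow_le_pow_right hp.pos (by omega)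
        _ = p := pow_one p
    · have hbot : (powMonoidHom p : D →* D).ker = ⊥ := by
        rw [Subgroup.eq_bot_iff_forall]
        intro y hy
        have h1 : y ^ p = 1 := hy
        have h2 : y ^ m = 1 := Subtype.ext (by simpa using hexp y)
        have hc : Nat.Coprime p m := (Nat.Prime.coprime_iff_not_dvd hp).2 hpm
        have := Nat.dvd_gcd (orderOf_dvd_of_pow_eq_one h1) (orderOf_dvd_of_pow_eq_one h2)
        rw [hc, Nat.dvd_one, orderOf_eq_one_iff] at this
        exact this
      rw [hbot, Subgroup.card_bot]
      exact hp.pos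
  have hn (n : ℕ) (hn : n ≠ 0) : Nat.card (powMonoidHom n : D →* D).ker ≤ n := by
    induction n using Nat.recOnMul with
    | zero => exact absurd rfl hn
    | one =>
      have hbot : (powMonoidHom 1 : D →* D).ker = ⊥ := by
        rw [Subgroup.eq_bot_iff_forall]
        intro y hy
        simpa [MonoidHom.mem_ker] using hy
      rw [hbot, Subgroup.card_bot]
    | prime p hp' => exact hp p hp'
    | mul a b iha ihb =>
      exact (card_ker_powMonoidHom_mul_le a b).trans
        (Nat.mul_le_mul (iha (left_ne_zero_of_mul hn)) (ihb (right_ne_zero_of_mul hn)))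
  have hcyc : IsCyclic D := by
    classical
    have := Fintype.ofFinite D
    refine isCyclic_of_card_pow_eq_one_le fun n hn' ↦ ?_
    rw [← card_ker_powMonoidHom]
    exact hn n hn'.ne'
  rw [← IsCyclic.exponent_eq_card]
  exact Monoid.exponent_dvd_of_forall_pow_eq_one fun y ↦ Subtype.ext (by simpa using hexp y)

end CyclicProduct

/-! ### Centralisers and tori in SL₂ in characteristic two -/

section SL2

open Matrix

variable {F : Type*} [Field F] [CharP F 2]

local notation "SL₂" => Matrix.SpecialLinearGroup (Fin 2) F

lemma SL2.mul_apply (x y : SL₂) (i j : Fin 2) : (x * y) i j = x i 0 * y 0 j + x i 1 * y 1 j :=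
  (Matrix.mul_apply).trans (Fin.sum_univ_two _)

lemma SL2.one_apply_same (i : Fin 2) : (1 : SL₂) i i = 1 := Matrix.one_apply_eq i

lemma SL2.one_apply_ne {i j : Fin 2} (h : i ≠ j) : (1 : SL₂) i j = 0 := Matrix.one_apply_ne h

/-- The trace. -/
def SL2.tr (x : SL₂) : F := x 0 0 + x 1 1

lemma SL2.tr_mul_comm (x y : SL₂) : SL2.tr (x * y) = SL2.tr (y * x) := by
  simp [SL2.tr, Matrix.mul_apply]; ring

lemma SL2.ext' {x y : SL₂} (h₁ : x 0 0 = y 0 0) (h₂ : x 0 1 = y 0 1) (h₃ : x 1 0 = y 1 0)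
    (h₄ : x 1 1 = y 1 1) : x = y := by
  ext i j
  fin_cases i <;> fin_cases j <;> assumption

lemma SL2.det_eq (x : SL₂) : x 0 0 * x 1 1 = 1 + x 0 1 * x 1 0 := by
  have := x.2
  rw [Matrix.det_fin_two] at this
  linear_combination this

/-- The entries of commuting matrices of determinant one are proportional off the diagonal. -/
lemma SL2.offDiag_eq {x y : SL₂} (h : Commute x y) :
    SL2.tr x * y 0 1 = SL2.tr y * x 0 1 ∧ SL2.tr x * y 1 0 = SL2.tr y * x 1 0 := by
  have h01 := congrArg (fun z : SL₂ ↦ z 0 1) h.eq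
  have h10 := congrArg (fun z : SL₂ ↦ z 1 0) h.eq
  simp only [SL2.mul_apply] at h01 h10
  rw [SL2.tr, SL2.tr]
  constructor <;> grind

/-- The off-diagonal entries agree by `SL2.offDiag_eq`; the diagonal entries then have equal sum and
equal product, so they agree up to order. -/
lemma SL2.eq_or_eq_inv {x y : SL₂} (h : Commute x y) (ht : SL2.tr x ≠ 0)
    (hxy : SL2.tr x = SL2.tr y) : y = x ∨ y = x⁻¹ := by
  obtain ⟨h1, h2⟩ := SL2.offDiag_eq h
  rw [← hxy] at h1 h2
  replace h1 := mul_left_cancel₀ ht h1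
  replace h2 := mul_left_cancel₀ ht h2
  have dx := SL2.det_eq x
  have dy := SL2.det_eq y
  rw [SL2.tr, SL2.tr] at hxy
  have h3 : (y 0 0 - x 0 0) * (y 0 0 - x 1 1) = 0 := by
    rw [h1, h2] at dy
    grind
  rcases mul_eq_zero.1 h3 with h3 | h3 <;> rw [sub_eq_zero] at h3
  · left
    apply SL2.ext' h3 h1 h2
    linear_combination -hxy - h3
  · right
    apply SL2.ext' <;> simp [Matrix.SpecialLinearGroup.coe_inv, Matrix.adjugate_fin_two, h1, h2, h3] <;> grind

lemma SL2.eq_one_of_trace_eq_zero {x y : SL₂} (h : Commute x y) (ht : SL2.tr x ≠ 0)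
    (hy : SL2.tr y = 0) : y = 1 := by
  obtain ⟨h1, h2⟩ := SL2.offDiag_eq h
  rw [hy, zero_mul, mul_eq_zero, or_iff_right ht] at h1 h2
  have dy := SL2.det_eq y
  rw [SL2.tr] at hy
  have h3 : (y 0 0 - 1) * (y 0 0 - 1) = 0 := by
    rw [h1] at dy
    grind
  rw [mul_self_eq_zero, sub_eq_zero] at h3
  apply SL2.ext' <;> simp [h1, h2, h3]
  grind

/-- Cayley–Hamilton: y² = tr(y) y + 1 in characteristic two. -/
lemma SL2.mul_self_of_trace_eq_zero {y : SL₂} (hy : SL2.tr y = 0) : y * y = 1 := by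
  have dy := SL2.det_eq y
  rw [SL2.tr] at hy
  apply SL2.ext' <;> simp [Matrix.mul_apply] <;> grind

lemma SL2.trace_eq_zero_of_mul_self {y : SL₂} (hy : y * y = 1) : SL2.tr y = 0 := by
  have h00 := congrArg (fun z : SL₂ ↦ z 0 0) hy
  have h11 := congrArg (fun z : SL₂ ↦ z 1 1) hy
  simp only [SL2.mul_apply, SL2.one_apply_same] at h00 h11
  have h : SL2.tr y * SL2.tr y = 0 := by
    rw [SL2.tr]
    grind
  exact mul_self_eq_zero.1 h

lemma SL2.commute_of_commute {x y z : SL₂} (ht : SL2.tr x ≠ 0) (hy : Commute x y)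
    (hz : Commute x z) : Commute y z := by
  obtain ⟨h1, h2⟩ := SL2.offDiag_eq hy
  obtain ⟨h3, h4⟩ := SL2.offDiag_eq hz
  have ht2 := mul_ne_zero ht ht
  have hy' : SL2.tr y = y 0 0 + y 1 1 := rfl
  have hz' : SL2.tr z = z 0 0 + z 1 1 := rfl
  have two : (2 : F) = 0 := CharTwo.two_eq_zero
  have h5 : SL2.tr y * z 0 1 = SL2.tr z * y 0 1 := by
    refine mul_left_cancel₀ ht ?_
    linear_combination SL2.tr y * h3 - SL2.tr z * h1
  have h6 : SL2.tr y * z 1 0 = SL2.tr z * y 1 0 := by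
    refine mul_left_cancel₀ ht ?_
    linear_combination SL2.tr y * h4 - SL2.tr z * h2
  have h7 : y 0 1 * z 1 0 = z 0 1 * y 1 0 := by
    refine mul_left_cancel₀ ht2 ?_
    linear_combination SL2.tr x * z 1 0 * h1 + SL2.tr y * x 0 1 * h4 - SL2.tr x * y 1 0 * h3 -
      SL2.tr z * x 0 1 * h2
  rw [hy', hz'] at h5 h6
  apply SL2.ext' <;> simp only [SL2.mul_apply]
  · linear_combination h7
  · linear_combination h5 + (y 0 1 * z 1 1 - y 1 1 * z 0 1) * two
  · linear_combination h6 + (y 1 0 * z 0 0 - y 0 0 * z 1 0) * two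
  · linear_combination -h7

lemma eq_one_of_mul_self_of_odd {G : Type*} [Group G] {y : G} {m : ℕ} (hm : Odd m)
    (h : y * y = 1) (hy : y ^ m = 1) : y = 1 := by
  obtain ⟨k, rfl⟩ := hm
  rwa [pow_succ, pow_mul, pow_two, h, one_pow, one_mul] at hy

variable [Finite F]

/-- On this abelian centraliser the trace is at most two-to-one, as it determines an element up to
inversion. -/
lemma SL2.card_centralizer_le {x : SL₂} (ht : SL2.tr x ≠ 0) :
    Nat.card (Subgroup.centralizer {x}) ≤ 2 * Nat.card F := by
  classical
  have := Fintype.ofFinite F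
  have := Fintype.ofFinite (Subgroup.centralizer {x})
  rw [Nat.card_eq_fintype_card, Nat.card_eq_fintype_card]
  have := Finset.card_le_mul_card_image (f := fun y : Subgroup.centralizer {x} ↦ SL2.tr y.1)
    Finset.univ 2 ?_
  · exact this.trans (Nat.mul_le_mul le_rfl (Finset.card_le_univ _))
  · intro a ha
    obtain ⟨y, -, rfl⟩ := Finset.mem_image.1 ha
    refine (Finset.card_le_card (t := {y, y⁻¹}) fun z hz ↦ ?_).trans Finset.card_le_two
    have hcomm {u : Subgroup.centralizer {x}} : Commute x u.1 :=
      (Subgroup.mem_centralizer_singleton_iff.1 u.2).symm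
    have htr : SL2.tr z.1 = SL2.tr y.1 := by simpa using hz
    rw [Finset.mem_insert, Finset.mem_singleton]
    by_cases h0 : SL2.tr y.1 = 0
    · left
      exact Subtype.ext ((SL2.eq_one_of_trace_eq_zero hcomm ht (htr.trans h0)).trans
        (SL2.eq_one_of_trace_eq_zero hcomm ht h0).symm)
    · have hyz : Commute y.1 z.1 := SL2.commute_of_commute ht hcomm hcomm
      exact (SL2.eq_or_eq_inv hyz h0 htr.symm).imp Subtype.ext Subtype.ext

/-- The normaliser of a maximal torus of `SL₂` in characteristic two. -/
lemma SL2.mul_self_mem_of_conj_mem {H : Subgroup SL₂} {m : ℕ} (hc : ∀ x ∈ H, ∀ y ∈ H, Commute x y)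
    (hm : Odd m) (hH : Nat.card H = m) (hq : 2 * Nat.card F < 3 * m) {x h : SL₂} (hx : x ∈ H)
    (hx1 : x ≠ 1) (hh : h * x * h⁻¹ ∈ H) : h * h ∈ H := by
  have hpow (y) (hy : y ∈ H) : y ^ m = 1 := by
    have : (⟨y, hy⟩ : H) ^ m = 1 := by rw [← hH, pow_card_eq_one']
    exact congrArg Subtype.val this
  have ht : SL2.tr x ≠ 0 := fun h0 ↦
    hx1 (eq_one_of_mul_self_of_odd hm (SL2.mul_self_of_trace_eq_zero h0) (hpow x hx))
  -- Conjugation keeps the trace, so h sends x to x or x⁻¹ and h² centralises x. It remains to see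
  -- that H is the whole centraliser.
  have hcomm : Commute x (h * h) := by
    have htr : SL2.tr x = SL2.tr (h * x * h⁻¹) := by
      rw [SL2.tr_mul_comm, ← mul_assoc, inv_mul_cancel, one_mul]
    rcases SL2.eq_or_eq_inv (hc x hx _ hh) ht htr with h1 | h1
    · rw [mul_inv_eq_iff_eq_mul] at h1
      have : Commute x h := h1.symm
      exact this.mul_right this
    · have h2 : h * x = x⁻¹ * h := mul_inv_eq_iff_eq_mul.1 h1
      have h3 : x * h = h * x⁻¹ := by
        rw [eq_mul_inv_iff_mul_eq, mul_assoc, h2, mul_inv_cancel_left]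
      rw [commute_iff_eq, ← mul_assoc, h3, mul_assoc, ← h2, mul_assoc]
  set C := Subgroup.centralizer ({x} : Set SL₂) with hC
  have hmemC {y} : y ∈ C ↔ Commute x y := by
    rw [hC, Subgroup.mem_centralizer_singleton_iff]
    exact ⟨fun h ↦ h.symm, fun h ↦ h.symm⟩
  have hHC : H ≤ C := fun y hy ↦ hmemC.2 (hc x hx y hy)
  have hodd : Odd (Nat.card C) := by
    by_contra hev
    rw [Nat.not_odd_iff_even, even_iff_two_dvd] at hev
    have := Fact.mk Nat.prime_two
    obtain ⟨⟨y, hyC⟩, hy⟩ := exists_prime_orderOf_dvd_card' 2 hev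
    have hy2 : y * y = 1 := by
      have := pow_orderOf_eq_one (⟨y, hyC⟩ : C)
      rw [hy, pow_two] at this
      exact congrArg Subtype.val this
    have htr : SL2.tr y = 0 := SL2.trace_eq_zero_of_mul_self hy2
    have := SL2.eq_one_of_trace_eq_zero (hmemC.1 hyC) ht htr
    subst this
    rw [show (⟨1, hyC⟩ : C) = 1 from rfl, orderOf_one] at hy
    omega
  obtain ⟨r, hr⟩ := Subgroup.card_dvd_of_le hHC
  have hle := SL2.card_centralizer_le ht
  rw [← hC, hr, hH] at hle
  rw [hr] at hodd
  have hr1 : r = 1 := by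
    have := (Nat.odd_mul.1 hodd).2
    -- The index r of H in the centraliser is odd, and m r ≤ 2q < 3m leaves only r = 1.
    have : r < 3 := by
      by_contra hr3
      nlinarith
    obtain ⟨k, rfl⟩ := Nat.odd_iff.2 (Nat.odd_iff.1 ‹Odd r›)
    omega
  have : H = C := Subgroup.eq_of_le_of_card_ge hHC (by rw [hr, hr1, mul_one])
  rw [this]
  exact hmemC.2 hcomm

end SL2

/-! ### Subgroups generated by two commuting factors -/

section Products

variable {A C S : Type*} [Group A] [Group C] [Group S]

/-- The preimage of a subgroup of the range of an injective homomorphism. -/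
noncomputable def comapEquivOfInjective {j : A →* S} (hj : Function.Injective j) {M : Subgroup S}
    (hM : M ≤ j.range) : M.comap j ≃* M :=
  ((M.comap j).equivMapOfInjective j hj).trans
    (MulEquiv.subgroupCongr (Subgroup.map_comap_eq_self hM))

lemma sup_eq_map_prod (k : A × C →* S) {M₁ M₂ : Subgroup S}
    (h₁ : M₁ ≤ (k.comp (MonoidHom.inl A C)).range) (h₂ : M₂ ≤ (k.comp (MonoidHom.inr A C)).range) :
    M₁ ⊔ M₂ = ((M₁.comap (k.comp (MonoidHom.inl A C))).prod
      (M₂.comap (k.comp (MonoidHom.inr A C)))).map k := by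
  apply le_antisymm
  · rw [sup_le_iff]
    constructor
    · intro g hg
      obtain ⟨h, rfl⟩ := h₁ hg
      exact ⟨(h, 1), ⟨hg, one_mem _⟩, rfl⟩
    · intro g hg
      obtain ⟨h, rfl⟩ := h₂ hg
      exact ⟨(1, h), ⟨one_mem _, hg⟩, rfl⟩
  · rintro _ ⟨⟨a, b⟩, ⟨ha, hb⟩, rfl⟩
    rw [show (a, b) = (a, 1) * (1, b) by simp, map_mul]
    exact Subgroup.mul_mem_sup ha hb

end Products

/-! ### The tori of class A₂ and their normalisers in Sp₄ -/

section Torus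

open Matrix

variable {F : Type*} [Field F] [CharP F 2]

local notation "SL₂" => Matrix.SpecialLinearGroup (Fin 2) F

/-- The action of `SL₂ × SL₂` on the orthogonal sum of two hyperbolic planes. -/
def planeMap (h : SL₂ × SL₂) : V4 F →ₗ[F] V4 F where
  toFun x := Sum.elim
    ![h.1 0 0 * x (.inl 0) + h.1 0 1 * x (.inr 0), h.2 0 0 * x (.inl 1) + h.2 0 1 * x (.inr 1)]
    ![h.1 1 0 * x (.inl 0) + h.1 1 1 * x (.inr 0), h.2 1 0 * x (.inl 1) + h.2 1 1 * x (.inr 1)]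
  map_add' x y := by apply V4.ext <;> simp <;> ring
  map_smul' c x := by apply V4.ext <;> simp <;> ring

lemma planeMap_apply (h : SL₂ × SL₂) (x : V4 F) : planeMap h x = Sum.elim
    ![h.1 0 0 * x (.inl 0) + h.1 0 1 * x (.inr 0), h.2 0 0 * x (.inl 1) + h.2 0 1 * x (.inr 1)]
    ![h.1 1 0 * x (.inl 0) + h.1 1 1 * x (.inr 0), h.2 1 0 * x (.inl 1) + h.2 1 1 * x (.inr 1)] :=
  rfl

lemma B_planeMap (h : SL₂ × SL₂) (x y : V4 F) : B (planeMap h x) (planeMap h y) = B x y := by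
  have h1 := SL2.det_eq h.1
  have h2 := SL2.det_eq h.2
  simp only [planeMap_apply, B, Sum.elim_inl, Sum.elim_inr, cons_val_zero, cons_val_one,
    cons_val_fin_one]
  grind

/-- The embedding of `SL₂ × SL₂` in `Sp₄`. -/
def planes : SL₂ × SL₂ →* Sp4 F where
  toFun h := ofIsometry (planeMap h) (B_planeMap h)
  map_one' := Sp4.ext_ap fun x ↦ by
    simp only [ap_ofIsometry, planeMap_apply, Prod.fst_one, Prod.snd_one, SL2.one_apply_same,
      SL2.one_apply_ne zero_ne_one, SL2.one_apply_ne one_ne_zero, ap_one]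
    apply V4.ext <;> simp
  map_mul' g h := Sp4.ext_ap fun x ↦ by
    simp only [ap_mul, ap_ofIsometry, planeMap_apply, Prod.fst_mul, Prod.snd_mul, SL2.mul_apply]
    apply V4.ext <;> simp <;> ring

lemma ap_planes (h : SL₂ × SL₂) (x : V4 F) : ap (planes h) x = Sum.elim
    ![h.1 0 0 * x (.inl 0) + h.1 0 1 * x (.inr 0), h.2 0 0 * x (.inl 1) + h.2 0 1 * x (.inr 1)]
    ![h.1 1 0 * x (.inl 0) + h.1 1 1 * x (.inr 0), h.2 1 0 * x (.inl 1) + h.2 1 1 * x (.inr 1)] :=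
  ap_ofIsometry _ (B_planeMap h) x

lemma planes_injective : Function.Injective (planes (F := F)) := by
  intro g h hgh
  have H (x : V4 F) (i) : ap (planes g) x i = ap (planes h) x i := by rw [hgh]
  simp only [ap_planes] at H
  ext1
  · apply SL2.ext'
    · simpa [e₁] using H e₁ (.inl 0)
    · simpa [f₁] using H f₁ (.inl 0)
    · simpa [e₁] using H e₁ (.inr 0)
    · simpa [f₁] using H f₁ (.inr 0)
  · apply SL2.ext'
    · simpa [e₂] using H e₂ (.inl 1)
    · simpa [f₂] using H f₂ (.inl 1)
    · simpa [e₂] using H e₂ (.inr 1)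
    · simpa [f₂] using H f₂ (.inr 1)

/-- Membership of the plane spanned by `e₁` and `f₁`. -/
def InPlane₁ (x : V4 F) : Prop := x (.inl 1) = 0 ∧ x (.inr 1) = 0

/-- Membership of the plane spanned by `e₂` and `f₂`. -/
def InPlane₂ (x : V4 F) : Prop := x (.inl 0) = 0 ∧ x (.inr 0) = 0

/-- A symplectic matrix that stabilises both planes comes from `SL₂ × SL₂`. -/
lemma exists_planes_eq {g : Sp4 F} (he₁ : InPlane₁ (ap g e₁)) (hf₁ : InPlane₁ (ap g f₁))
    (he₂ : InPlane₂ (ap g e₂)) (hf₂ : InPlane₂ (ap g f₂)) : ∃ h, g = planes h := by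
  have h1 : B (ap g e₁) (ap g f₁) = 1 := by rw [B_ap_ap, isSympBasis_std.ac]
  have h2 : B (ap g e₂) (ap g f₂) = 1 := by rw [B_ap_ap, isSympBasis_std.bd]
  obtain ⟨p1, p2⟩ := he₁
  obtain ⟨p3, p4⟩ := hf₁
  obtain ⟨p5, p6⟩ := he₂
  obtain ⟨p7, p8⟩ := hf₂
  simp only [B, p1, p2, p3, p4, p5, p6, p7, p8] at h1 h2
  refine ⟨(⟨!![ap g e₁ (.inl 0), ap g f₁ (.inl 0); ap g e₁ (.inr 0), ap g f₁ (.inr 0)], ?_⟩,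
    ⟨!![ap g e₂ (.inl 1), ap g f₂ (.inl 1); ap g e₂ (.inr 1), ap g f₂ (.inr 1)], ?_⟩), ?_⟩
  · rw [Matrix.det_fin_two_of]; grind
  · rw [Matrix.det_fin_two_of]; grind
  · refine Sp4.ext_ap fun x ↦ ?_
    rw [ap_planes]
    conv_lhs => rw [eq_sum_std x]
    apply V4.ext <;> simp [p1, p2, p3, p4, p5, p6, p7, p8] <;> ring

/-- In characteristic two det(y − 1) = tr y, so y − 1 is invertible. -/
lemma SL2.eq_zero_of_fixed {y : SL₂} (ht : SL2.tr y ≠ 0) {a b : F} (h₁ : y 0 0 * a + y 0 1 * b = a)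
    (h₂ : y 1 0 * a + y 1 1 * b = b) : a = 0 ∧ b = 0 := by
  have hd := SL2.det_eq y
  have hy : SL2.tr y = y 0 0 + y 1 1 := rfl
  have two : (2 : F) = 0 := CharTwo.two_eq_zero
  constructor <;> refine (mul_eq_zero.1 (?_ : SL2.tr y * _ = 0)).resolve_left ht <;> rw [hy] <;>
    grind

lemma inPlane₂_of_fixed {h : SL₂ × SL₂} (ht : SL2.tr h.1 ≠ 0) {x : V4 F}
    (hx : ap (planes h) x = x) : InPlane₂ x := by
  have h0 := congrFun hx (.inl 0)
  have h1 := congrFun hx (.inr 0)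
  simp only [ap_planes, Sum.elim_inl, Sum.elim_inr, cons_val_zero] at h0 h1
  exact SL2.eq_zero_of_fixed ht h0 h1

lemma inPlane₁_of_fixed {h : SL₂ × SL₂} (ht : SL2.tr h.2 ≠ 0) {x : V4 F}
    (hx : ap (planes h) x = x) : InPlane₁ x := by
  have h0 := congrFun hx (.inl 1)
  have h1 := congrFun hx (.inr 1)
  simp only [ap_planes, Sum.elim_inl, Sum.elim_inr, cons_val_one, cons_val_fin_one] at h0 h1
  exact SL2.eq_zero_of_fixed ht h0 h1

lemma ap_planes_of_inPlane₂ (y : SL₂) {x : V4 F} (hx : InPlane₂ x) :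
    ap (planes (y, 1)) x = x := by
  simp only [ap_planes, hx.1, hx.2, SL2.one_apply_same,
      SL2.one_apply_ne zero_ne_one, SL2.one_apply_ne one_ne_zero]
  apply V4.ext <;> simp [hx.1, hx.2]

lemma ap_planes_of_inPlane₁ (y : SL₂) {x : V4 F} (hx : InPlane₁ x) :
    ap (planes (1, y)) x = x := by
  simp only [ap_planes, hx.1, hx.2, SL2.one_apply_same,
      SL2.one_apply_ne zero_ne_one, SL2.one_apply_ne one_ne_zero]
  apply V4.ext <;> simp [hx.1, hx.2]

lemma not_forall_inPlane₁ (g : Sp4 F) : ¬ ((∀ x, InPlane₁ x → InPlane₁ (ap g x)) ∧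
    ∀ x, InPlane₂ x → InPlane₁ (ap g x)) := by
  rintro ⟨h1, h2⟩
  have hx (x) : InPlane₁ (ap g x) := by
    rw [eq_sum_std x, show x (.inl 0) • e₁ + x (.inl 1) • e₂ + x (.inr 0) • f₁ + x (.inr 1) • f₂ =
      (x (.inl 0) • e₁ + x (.inr 0) • f₁) + (x (.inl 1) • e₂ + x (.inr 1) • f₂) by abel, ap_add]
    have ha := h1 (x (.inl 0) • e₁ + x (.inr 0) • f₁) (by constructor <;> simp [e₁, f₁])
    have hb := h2 (x (.inl 1) • e₂ + x (.inr 1) • f₂) (by constructor <;> simp [e₂, f₂])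
    exact ⟨by rw [Pi.add_apply, ha.1, hb.1, add_zero], by rw [Pi.add_apply, ha.2, hb.2, add_zero]⟩
  have := (hx (ap g⁻¹ e₂)).1
  simp [e₂] at this

lemma not_forall_inPlane₂ (g : Sp4 F) : ¬ ((∀ x, InPlane₁ x → InPlane₂ (ap g x)) ∧
    ∀ x, InPlane₂ x → InPlane₂ (ap g x)) := by
  rintro ⟨h1, h2⟩
  have hx (x) : InPlane₂ (ap g x) := by
    rw [eq_sum_std x, show x (.inl 0) • e₁ + x (.inl 1) • e₂ + x (.inr 0) • f₁ + x (.inr 1) • f₂ =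
      (x (.inl 0) • e₁ + x (.inr 0) • f₁) + (x (.inl 1) • e₂ + x (.inr 1) • f₂) by abel, ap_add]
    have ha := h1 (x (.inl 0) • e₁ + x (.inr 0) • f₁) (by constructor <;> simp [e₁, f₁])
    have hb := h2 (x (.inl 1) • e₂ + x (.inr 1) • f₂) (by constructor <;> simp [e₂, f₂])
    exact ⟨by rw [Pi.add_apply, ha.1, hb.1, add_zero], by rw [Pi.add_apply, ha.2, hb.2, add_zero]⟩
  have := (hx (ap g⁻¹ e₁)).1
  simp [e₁] at this

lemma inPlane_std : InPlane₁ (e₁ : V4 F) ∧ InPlane₁ (f₁ : V4 F) ∧ InPlane₂ (e₂ : V4 F) ∧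
    InPlane₂ (f₂ : V4 F) := by
  refine ⟨⟨?_, ?_⟩, ⟨?_, ?_⟩, ⟨?_, ?_⟩, ?_, ?_⟩ <;> simp [e₁, e₂, f₁, f₂]

variable [Finite F]

/-- The normaliser of a torus of `SL₂ × SL₂` in `Sp₄` has exponent at most four modulo the
torus. -/
lemma pow_four_mem_of_conj_mem {H₁ H₂ : Subgroup SL₂} {m : ℕ}
    (hc₁ : ∀ x ∈ H₁, ∀ y ∈ H₁, Commute x y) (hc₂ : ∀ x ∈ H₂, ∀ y ∈ H₂, Commute x y)
    (hm : Odd m) (hm1 : 1 < m) (hH₁ : Nat.card H₁ = m) (hH₂ : Nat.card H₂ = m)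
    (hq : 2 * Nat.card F < 3 * m) {g : Sp4 F}
    (hg : ∀ x ∈ (H₁.prod H₂).map planes, g * x * g⁻¹ ∈ (H₁.prod H₂).map planes) :
    g ^ 4 ∈ (H₁.prod H₂).map planes := by
  have htr {H : Subgroup SL₂} (hH : Nat.card H = m) {y} (hy : y ∈ H) (hy1 : y ≠ 1) :
      SL2.tr y ≠ 0 := fun h0 ↦ hy1 <| eq_one_of_mul_self_of_odd hm
        (SL2.mul_self_of_trace_eq_zero h0) <| by
    have : (⟨y, hy⟩ : H) ^ m = 1 := by rw [← hH, pow_card_eq_one']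
    exact congrArg Subtype.val this
  obtain ⟨x₁, hx₁, hx₁1⟩ := H₁.one_lt_card_iff_ne_bot.1 (hH₁ ▸ hm1) |> H₁.ne_bot_iff_exists_ne_one.1 |>
    fun ⟨x, hx⟩ ↦ (⟨x.1, x.2, fun h ↦ hx (Subtype.ext h)⟩ : ∃ x, x ∈ H₁ ∧ x ≠ 1)
  obtain ⟨x₂, hx₂, hx₂1⟩ := H₂.one_lt_card_iff_ne_bot.1 (hH₂ ▸ hm1) |> H₂.ne_bot_iff_exists_ne_one.1 |>
    fun ⟨x, hx⟩ ↦ (⟨x.1, x.2, fun h ↦ hx (Subtype.ext h)⟩ : ∃ x, x ∈ H₂ ∧ x ≠ 1)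
  have hmem {a b} (ha : a ∈ H₁) (hb : b ∈ H₂) : planes (a, b) ∈ (H₁.prod H₂).map planes :=
    Subgroup.mem_map_of_mem _ ⟨ha, hb⟩
  -- a vector fixed by a nontrivial element of the torus lies in one of the planes
  have fixed {a b} (ha : a ∈ H₁) (hb : b ∈ H₂) (hab : planes (a, b) ≠ 1) :
      (∀ x, ap (planes (a, b)) x = x → InPlane₁ x) ∨
        (∀ x, ap (planes (a, b)) x = x → InPlane₂ x) := by
    by_cases ha1 : a = 1
    · left
      refine fun x hx ↦ inPlane₁_of_fixed (htr hH₂ hb ?_) hx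
      rintro rfl
      exact hab (by rw [ha1]; exact map_one _)
    · exact .inr fun x hx ↦ inPlane₂_of_fixed (htr hH₁ ha ha1) hx
  -- Vectors fixed by a torus element are carried by g to vectors fixed by its conjugate, again a
  -- nontrivial torus element. So g maps each plane into one of the two planes.
  have move {a b} (ha : a ∈ H₁) (hb : b ∈ H₂) (hab : (a, b) ≠ 1) {P : V4 F → Prop}
      (hP : ∀ x, P x → ap (planes (a, b)) x = x) :
      (∀ x, P x → InPlane₁ (ap g x)) ∨ (∀ x, P x → InPlane₂ (ap g x)) := by
    obtain ⟨⟨a', b'⟩, ⟨ha', hb'⟩, hab'⟩ := hg _ (hmem ha hb)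
    have hne : planes (a', b') ≠ 1 := by
      rw [hab']
      intro h
      rw [mul_inv_eq_one, mul_eq_left] at h
      exact hab (planes_injective (h.trans (map_one _).symm))
    have hfix (x) (hx : P x) : ap (planes (a', b')) (ap g x) = ap g x := by
      rw [hab', ap_mul, ap_mul, ap_inv_ap, hP x hx]
    exact (fixed ha' hb' hne).imp (fun h x hx ↦ h _ (hfix x hx)) fun h x hx ↦ h _ (hfix x hx)
  have move₂ := move hx₁ H₂.one_mem (by simpa using hx₁1) fun x ↦ ap_planes_of_inPlane₂ x₁
  have move₁ := move H₁.one_mem hx₂ (by simpa using hx₂1) fun x ↦ ap_planes_of_inPlane₁ x₂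
  -- By surjectivity g cannot send both planes into one, so it preserves or swaps them and g²
  -- preserves both. Squaring once more lands in the torus by the SL₂ result applied in each factor.
  have hgg : (∀ x, InPlane₁ x → InPlane₁ (ap (g * g) x)) ∧
      ∀ x, InPlane₂ x → InPlane₂ (ap (g * g) x) := by
    simp only [ap_mul]
    rcases move₁ with h1 | h1 <;> rcases move₂ with h2 | h2
    · exact absurd ⟨h1, h2⟩ (not_forall_inPlane₁ g)
    · exact ⟨fun x hx ↦ h1 _ (h1 x hx), fun x hx ↦ h2 _ (h2 x hx)⟩
    · exact ⟨fun x hx ↦ h2 _ (h1 x hx), fun x hx ↦ h1 _ (h2 x hx)⟩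
    · exact absurd ⟨h1, h2⟩ (not_forall_inPlane₂ g)
  obtain ⟨p1, p2, p3, p4⟩ := inPlane_std (F := F)
  obtain ⟨⟨h₁, h₂⟩, hh⟩ := exists_planes_eq (hgg.1 _ p1) (hgg.1 _ p2) (hgg.2 _ p3) (hgg.2 _ p4)
  have hconj {a b} (ha : a ∈ H₁) (hb : b ∈ H₂) : h₁ * a * h₁⁻¹ ∈ H₁ ∧ h₂ * b * h₂⁻¹ ∈ H₂ := by
    have := hg _ (hg _ (hmem ha hb))
    rw [show g * (g * planes (a, b) * g⁻¹) * g⁻¹ = (g * g) * planes (a, b) * (g * g)⁻¹ by group,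
      hh, ← map_mul, ← map_inv, ← map_mul] at this
    obtain ⟨c, hc, hc'⟩ := this
    rw [planes_injective hc'] at hc
    exact hc
  have k₁ := SL2.mul_self_mem_of_conj_mem hc₁ hm hH₁ hq hx₁ hx₁1 (hconj hx₁ hx₂).1
  have k₂ := SL2.mul_self_mem_of_conj_mem hc₂ hm hH₂ hq hx₂ hx₂1 (hconj hx₁ hx₂).2
  rw [show g ^ 4 = (g * g) * (g * g) by rw [pow_succ, pow_succ, pow_two, mul_assoc (g * g)], hh,
    ← map_mul]
  exact hmem k₁ k₂

/-- The tori of the class `A₂` are conjugate to subgroups of the standard `SL₂ × SL₂`. -/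
lemma IsCyclicSquare.exists_eq_map {m : ℕ} {M : Subgroup (Sp4 F)} (hM : IsCyclicSquare m M) :
    ∃ (s : Sp4 F) (H₁ H₂ : Subgroup SL₂), IsCyclic H₁ ∧ IsCyclic H₂ ∧ Nat.card H₁ = m ∧
      Nat.card H₂ = m ∧ M = ((H₁.prod H₂).map planes).map (MulAut.conj s).toMonoidHom := by
  obtain ⟨U, W, ⟨hU, hW, hUW, hperp⟩, M₁, M₂, hc₁, hm₁, hM₁, hc₂, hm₂, hM₂, rfl⟩ := hM
  replace hperp : ∀ u ∈ U, ∀ w ∈ W, B u w = 0 := fun u hu w hw ↦ by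
    rw [← dotProduct_J_mulVec]; exact hperp u hu w hw
  have pair {U W : Submodule F (V4 F)} (hU : Module.finrank F U = 2) (hUW : IsCompl U W)
      (hperp : ∀ u ∈ U, ∀ w ∈ W, B u w = 0) : ∃ u ∈ U, ∃ u' ∈ U, B u u' = 1 := by
    obtain ⟨⟨u, hu⟩, hu0⟩ := Module.finrank_pos_iff_exists_ne_zero.1 (by rw [hU]; exact two_pos :
      0 < Module.finrank F U)
    obtain ⟨x, hx⟩ := exists_B_eq_one (v := u) (by simpa using hu0)
    have hxUW : x ∈ U ⊔ W := by rw [hUW.sup_eq_top]; trivial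
    obtain ⟨u', hu', w, hw, rfl⟩ := Submodule.mem_sup.1 hxUW
    refine ⟨u, hu, u', hu', ?_⟩
    rwa [B_add_right, hperp u hu w hw, add_zero] at hx
  obtain ⟨u, hu, u', hu', huu⟩ := pair hU hUW hperp
  obtain ⟨w, hw, w', hw', hww⟩ := pair hW hUW.symm fun w hw u hu ↦ by rw [B_comm, hperp u hu w hw]
  have hb : IsSympBasis u w u' w' :=
    ⟨hperp u hu w hw, huu, hperp u hu w' hw', by rw [B_comm, hperp u' hu' w hw], hww,
      hperp u' hu' w' hw'⟩
  obtain ⟨s, rfl, rfl, rfl, rfl⟩ := hb.exists_ap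
  let k : SL₂ × SL₂ →* Sp4 F := (MulAut.conj s).toMonoidHom.comp planes
  have hk : Function.Injective k := (MulAut.conj s).injective.comp planes_injective
  have k_apply (h) : k h = s * planes h * s⁻¹ := rfl
  have in₁ {x} (hx : ap s x ∈ U) : InPlane₁ x := by
    constructor
    · rw [← B_f₂ x, ← B_ap_ap s, hperp _ hx _ hw']
    · rw [← B_e₂ x, ← B_ap_ap s, hperp _ hx _ hw]
  have in₂ {x} (hx : ap s x ∈ W) : InPlane₂ x := by
    constructor
    · rw [← B_f₁ x, ← B_ap_ap s, B_comm, hperp _ hu' _ hx]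
    · rw [← B_e₁ x, ← B_ap_ap s, B_comm, hperp _ hu _ hx]
  have range₁ : ∀ g ∈ M₁, ∃ h, k (h, 1) = g := by
    intro g hg
    obtain ⟨a1, a2⟩ := hM₁ g hg
    have fe₂ : ap (s⁻¹ * g * s) e₂ = e₂ := by
      rw [ap_mul, ap_mul, show ap g (ap s e₂) = ap s e₂ from a2 _ hw, ap_inv_ap]
    have ff₂ : ap (s⁻¹ * g * s) f₂ = f₂ := by
      rw [ap_mul, ap_mul, show ap g (ap s f₂) = ap s f₂ from a2 _ hw', ap_inv_ap]
    have fe₁ : InPlane₁ (ap (s⁻¹ * g * s) e₁) := in₁ (by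
      rw [ap_mul, ap_mul, ap_ap_inv]; exact a1 _ hu)
    have ff₁ : InPlane₁ (ap (s⁻¹ * g * s) f₁) := in₁ (by
      rw [ap_mul, ap_mul, ap_ap_inv]; exact a1 _ hu')
    obtain ⟨_, _, p3, p4⟩ := inPlane_std (F := F)
    obtain ⟨⟨h₁, h₂⟩, hh⟩ := exists_planes_eq fe₁ ff₁ (by rwa [fe₂]) (by rwa [ff₂])
    rw [hh] at fe₂ ff₂
    have : h₂ = 1 := by
      apply SL2.ext'
      · simpa [ap_planes, e₂] using congrFun fe₂ (.inl 1)
      · simpa [ap_planes, f₂] using congrFun ff₂ (.inl 1)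
      · simpa [ap_planes, e₂] using congrFun fe₂ (.inr 1)
      · simpa [ap_planes, f₂] using congrFun ff₂ (.inr 1)
    subst this
    exact ⟨h₁, by rw [k_apply, ← hh]; group⟩
  have range₂ : ∀ g ∈ M₂, ∃ h, k (1, h) = g := by
    intro g hg
    obtain ⟨a1, a2⟩ := hM₂ g hg
    have fe₁ : ap (s⁻¹ * g * s) e₁ = e₁ := by
      rw [ap_mul, ap_mul, show ap g (ap s e₁) = ap s e₁ from a2 _ hu, ap_inv_ap]
    have ff₁ : ap (s⁻¹ * g * s) f₁ = f₁ := by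
      rw [ap_mul, ap_mul, show ap g (ap s f₁) = ap s f₁ from a2 _ hu', ap_inv_ap]
    have fe₂ : InPlane₂ (ap (s⁻¹ * g * s) e₂) := in₂ (by
      rw [ap_mul, ap_mul, ap_ap_inv]; exact a1 _ hw)
    have ff₂ : InPlane₂ (ap (s⁻¹ * g * s) f₂) := in₂ (by
      rw [ap_mul, ap_mul, ap_ap_inv]; exact a1 _ hw')
    obtain ⟨p1, p2, _, _⟩ := inPlane_std (F := F)
    obtain ⟨⟨h₁, h₂⟩, hh⟩ := exists_planes_eq (by rwa [fe₁]) (by rwa [ff₁]) fe₂ ff₂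
    rw [hh] at fe₁ ff₁
    have : h₁ = 1 := by
      apply SL2.ext'
      · simpa [ap_planes, e₁] using congrFun fe₁ (.inl 0)
      · simpa [ap_planes, f₁] using congrFun ff₁ (.inl 0)
      · simpa [ap_planes, e₁] using congrFun fe₁ (.inr 0)
      · simpa [ap_planes, f₁] using congrFun ff₁ (.inr 0)
    subst this
    exact ⟨h₂, by rw [k_apply, ← hh]; group⟩
  refine ⟨s, M₁.comap (k.comp (MonoidHom.inl SL₂ SL₂)), M₂.comap (k.comp (MonoidHom.inr SL₂ SL₂)),
    ?_⟩
  have le₁ : M₁ ≤ (k.comp (MonoidHom.inl SL₂ SL₂)).range := range₁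
  have le₂ : M₂ ≤ (k.comp (MonoidHom.inr SL₂ SL₂)).range := range₂
  have i₁ : Function.Injective (k.comp (MonoidHom.inl SL₂ SL₂)) :=
    hk.comp fun _ _ h ↦ congrArg Prod.fst h
  have i₂ : Function.Injective (k.comp (MonoidHom.inr SL₂ SL₂)) :=
    hk.comp fun _ _ h ↦ congrArg Prod.snd h
  have c₁ := comapEquivOfInjective i₁ le₁
  have c₂ := comapEquivOfInjective i₂ le₂
  refine ⟨c₁.isCyclic.2 hc₁, c₂.isCyclic.2 hc₂, (Nat.card_congr c₁.toEquiv).trans hm₁,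
    (Nat.card_congr c₂.toEquiv).trans hm₂, ?_⟩
  rw [Subgroup.map_map]
  exact sup_eq_map_prod k le₁ le₂

lemma commute_of_isCyclic {G : Type*} [Group G] {H : Subgroup G} (hH : IsCyclic H) :
    ∀ x ∈ H, ∀ y ∈ H, Commute x y := fun x hx y hy ↦ by
  obtain ⟨z, hz⟩ := hH
  obtain ⟨a, ha⟩ := hz ⟨x, hx⟩
  obtain ⟨b, hb⟩ := hz ⟨y, hy⟩
  rw [Subtype.ext_iff] at ha hb
  change (z : G) ^ a = x at ha
  change (z : G) ^ b = y at hb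
  rw [← ha, ← hb]
  exact (Commute.refl _).zpow_zpow a b

/-- The properties of the tori of the class `A₂`. -/
structure IsTorusLike {S : Type*} [Group S] (m : ℕ) (M : Subgroup S) : Prop where
  odd : Odd m
  one_lt : 1 < m
  card_eq : Nat.card M = m * m
  comm : ∀ x ∈ M, ∀ y ∈ M, Commute x y
  pow_four_mem : ∀ g, (∀ x ∈ M, g * x * g⁻¹ ∈ M) → g ^ 4 ∈ M
  card_dvd : ∀ D ≤ M, (∀ p, p.Prime → p ∣ m → ∃ x ∈ M, x ^ p = 1 ∧ x ∉ D) → Nat.card D ∣ m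

lemma IsCyclicSquare.isTorusLike {m : ℕ} {M : Subgroup (Sp4 F)} (hM : IsCyclicSquare m M)
    (hm : Odd m) (hm1 : 1 < m) (hq : 2 * Nat.card F < 3 * m) : IsTorusLike m M := by
  obtain ⟨s, H₁, H₂, hc₁, hc₂, hH₁, hH₂, rfl⟩ := hM.exists_eq_map
  have comm₁ := commute_of_isCyclic hc₁
  have comm₂ := commute_of_isCyclic hc₂
  have conj_mem {x} : s * x * s⁻¹ ∈ ((H₁.prod H₂).map planes).map (MulAut.conj s).toMonoidHom ↔
      x ∈ (H₁.prod H₂).map planes :=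
    Subgroup.mem_map_iff_mem (f := (MulAut.conj s).toMonoidHom) (MulAut.conj s).injective
  let _ : CommGroup H₁ := { mul_comm := fun x y ↦ Subtype.ext (comm₁ _ x.2 _ y.2) }
  let _ : CommGroup H₂ := { mul_comm := fun x y ↦ Subtype.ext (comm₂ _ x.2 _ y.2) }
  let j : H₁ × H₂ →* Sp4 F :=
    (MulAut.conj s).toMonoidHom.comp (planes.comp (H₁.subtype.prodMap H₂.subtype))
  have hj : Function.Injective j := (MulAut.conj s).injective.comp
    (planes_injective.comp (Prod.map_injective.2 ⟨H₁.subtype_injective, H₂.subtype_injective⟩))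
  have hrange : ((H₁.prod H₂).map planes).map (MulAut.conj s).toMonoidHom = j.range := by
    apply le_antisymm
    · rintro _ ⟨_, ⟨⟨a, b⟩, ⟨ha, hb⟩, rfl⟩, rfl⟩
      exact ⟨(⟨a, ha⟩, ⟨b, hb⟩), rfl⟩
    · rintro _ ⟨⟨a, b⟩, rfl⟩
      exact ⟨_, ⟨(a, b), ⟨a.2, b.2⟩, rfl⟩, rfl⟩
  refine ⟨hm, hm1, ?_, ?_, fun g hg ↦ ?_, fun D hD h ↦ ?_⟩
  · rw [hrange, ← Nat.card_congr (MonoidHom.ofInjective hj).toEquiv, Nat.card_prod, hH₁, hH₂]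
  · rw [hrange]
    rintro _ ⟨x, rfl⟩ _ ⟨y, rfl⟩
    exact (Commute.all x y).map j
  · have := pow_four_mem_of_conj_mem (g := s⁻¹ * g * s) comm₁ comm₂ hm hm1 hH₁ hH₂ hq fun x hx ↦ by
      have := hg _ (conj_mem.2 hx)
      rw [← conj_mem]
      convert this using 1
      group
    rw [← conj_mem] at this
    convert this using 1
    have h4 := conj_pow (i := 4) (a := s⁻¹) (b := g)
    rw [inv_inv] at h4
    rw [h4]
    group
  · rw [hrange] at hD h
    rw [← Nat.card_congr (comapEquivOfInjective hj hD).toEquiv]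
    refine card_dvd_of_forall_torsion (by omega) hH₁ hH₂ _ fun p hp hpm ↦ ?_
    obtain ⟨_, ⟨x, rfl⟩, hx, hxD⟩ := h p hp hpm
    exact ⟨x, hj (by rw [map_pow, hx, map_one]), hxD⟩

/-- The inequality n < m is what finally beats the field automorphisms. For m = q − 1 the condition
q > 4 also gives 2q < 3m. -/
lemma IsA2Torus.exists_isTorusLike {n : ℕ} (hn : Nat.card F = 2 ^ n) {M : Subgroup (Sp4 F)}
    (hM : IsA2Torus M) : ∃ m, n < m ∧ IsTorusLike m M := by
  have hlt := Nat.lt_two_pow_self (n := n)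
  have hn0 : n ≠ 0 := by
    rintro rfl
    have := Finite.one_lt_card (α := F)
    omega
  have hev : Even (Nat.card F) := by rw [hn]; exact (Nat.even_pow.2 ⟨even_two, hn0⟩)
  have h2 := Finite.one_lt_card (α := F)
  rcases hM with ⟨h4, hM⟩ | hM
  · refine ⟨_, ?_, hM.isTorusLike (Nat.Even.sub_odd h2.le hev odd_one) (by omega) (by omega)⟩
    obtain ⟨k, rfl⟩ := Nat.exists_eq_succ_of_ne_zero hn0
    have : k ≠ 0 := by rintro rfl; omega
    have := Nat.lt_two_pow_self (n := k)
    rw [hn, Nat.succ_eq_add_one, pow_succ] at *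
    omega
  · exact ⟨_, by omega, hM.isTorusLike hev.add_one (by omega) (by omega)⟩

end Torus

/-! ### Stabilisers along a 3-arc -/

section Graphs

variable {Ω G : Type*} [Group G] [MulAction G Ω] {Γ : Digraph Ω}

lemma isArc_three {a b c d : Ω} (h₁ : Γ.Adj a b) (h₂ : Γ.Adj b c) (h₃ : Γ.Adj c d) :
    IsArc Γ 3 ![a, b, c, d] := by
  intro i
  fin_cases i <;> assumption

lemma IsArcTransitive.exists_smul (h : IsArcTransitive G Γ 3) {a b c d a' b' c' d' : Ω}
    (h₁ : Γ.Adj a b) (h₂ : Γ.Adj b c) (h₃ : Γ.Adj c d) (h₁' : Γ.Adj a' b') (h₂' : Γ.Adj b' c')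
    (h₃' : Γ.Adj c' d') : ∃ g : G, g • a = a' ∧ g • b = b' ∧ g • c = c' ∧ g • d = d' := by
  obtain ⟨g, hg⟩ := h _ _ (isArc_three h₁ h₂ h₃) (isArc_three h₁' h₂' h₃')
  exact ⟨g, hg 0, hg 1, hg 2, hg 3⟩

lemma outValency_smul (hAut : ActsByAut G Γ) (g : G) (v : Ω) :
    outValency Γ (g • v) = outValency Γ v :=
  (Nat.card_congr ((MulAction.toPerm g).subtypeEquiv fun w ↦ (hAut g v w).symm)).symm

/-- Orbit counting for a group acting transitively on the out-neighbours of a vertex. -/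
lemma card_eq_outValency_mul [Finite Ω] (hAut : ActsByAut G Γ) {H : Subgroup G} {v w : Ω}
    (hv : ∀ h ∈ H, h • v = v) (hw : Γ.Adj v w)
    (htrans : ∀ w', Γ.Adj v w' → ∃ h ∈ H, h • w = w') :
    Nat.card H = outValency Γ v * Nat.card (H ⊓ MulAction.stabilizer G w : Subgroup G) := by
  have horb : MulAction.orbit H w = {w' | Γ.Adj v w'} := by
    ext w'
    constructor
    · rintro ⟨⟨h, hh⟩, rfl⟩
      have := (hAut h v w).2 hw
      rwa [hv h hh] at this
    · intro hw'
      obtain ⟨h, hh, rfl⟩ := htrans w' hw'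
      exact ⟨⟨h, hh⟩, rfl⟩
  have h1 := (MulAction.stabilizer H w).card_mul_index
  rw [MulAction.index_stabilizer, horb] at h1
  have h2 : Nat.card (MulAction.stabilizer H w) =
      Nat.card (H ⊓ MulAction.stabilizer G w : Subgroup G) :=
    Nat.card_congr
      { toFun := fun x ↦ ⟨x.1.1, x.1.2, x.2⟩
        invFun := fun x ↦ ⟨⟨x.1, x.2.1⟩, x.2.2⟩
        left_inv := fun _ ↦ rfl
        right_inv := fun _ ↦ rfl }
  rw [h2] at h1
  rw [← h1, mul_comm]
  rfl

lemma card_stabilizer_smul (g : G) (v : Ω) :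
    Nat.card (MulAction.stabilizer G (g • v)) = Nat.card (MulAction.stabilizer G v) := by
  rw [MulAction.stabilizer_smul_eq_stabilizer_map_conj]
  exact (Nat.card_congr ((MulAction.stabilizer G v).equivMapOfInjective _
    (MulAut.conj g).injective).toEquiv).symm

/-- The arithmetic of vertex and arc stabilisers in a `(G, 3)`-arc-transitive digraph. -/
lemma IsArcTransitive.exists_arc_stabilizer [Finite Ω] [MulAction.IsPretransitive G Ω]
    (hΓ : IsOriented Γ) (hval : ∀ x, outValency Γ x ≠ 0) (hAut : ActsByAut G Γ)
    (h : IsArcTransitive G Γ 3) (v : Ω) :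
    ∃ (u : Ω) (g : G) (k : ℕ), g • u = v ∧ g • v ≠ v ∧
      k ^ 3 ∣ Nat.card (MulAction.stabilizer G v) ∧
      Nat.card (MulAction.stabilizer G v) =
        k * Nat.card (MulAction.stabilizer G u ⊓ MulAction.stabilizer G v : Subgroup G) := by
  have hout (x) : ∃ y, Γ.Adj x y := by
    obtain ⟨⟨y, hy⟩⟩ := (Nat.card_ne_zero.1 (hval x)).1
    exact ⟨y, hy⟩
  obtain ⟨u, huv⟩ : ∃ u, Γ.Adj u v := by
    obtain ⟨y, hy⟩ := hout v
    obtain ⟨g, hg⟩ := MulAction.exists_smul_eq G y v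
    exact ⟨g • v, hg ▸ (hAut g v y).2 hy⟩
  obtain ⟨w, hvw⟩ := hout v
  obtain ⟨x, hwx⟩ := hout w
  obtain ⟨y, hxy⟩ := hout x
  obtain ⟨g, hg1, hg2, -⟩ := h.exists_smul huv hvw hwx hvw hwx hxy
  have hk (z) : outValency Γ z = outValency Γ v := by
    obtain ⟨g, rfl⟩ := MulAction.exists_smul_eq G v z
    exact outValency_smul hAut g v
  have hcard : Nat.card (MulAction.stabilizer G v) = Nat.card (MulAction.stabilizer G u) := by
    rw [← hg1, card_stabilizer_smul]
  -- Transitivity on 3-arcs makes the stabiliser of each initial segment transitive on its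
  -- continuations, so each of the three steps along u → v → w → x divides the order by the
  -- out-valency.
  have c₁ := card_eq_outValency_mul hAut (H := MulAction.stabilizer G u) (v := u) (w := v)
    (fun _ hh ↦ hh) huv fun v' huv' ↦ by
      obtain ⟨w', hw'⟩ := hout v'
      obtain ⟨x', hx'⟩ := hout w'
      obtain ⟨t, h1, h2, -⟩ := h.exists_smul huv hvw hwx huv' hw' hx'
      exact ⟨t, h1, h2⟩
  have c₂ := card_eq_outValency_mul hAut
    (H := MulAction.stabilizer G u ⊓ MulAction.stabilizer G v) (v := v) (w := w)
    (fun _ hh ↦ hh.2) hvw fun w' hw' ↦ by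
      obtain ⟨x', hx'⟩ := hout w'
      obtain ⟨t, h1, h2, h3, -⟩ := h.exists_smul huv hvw hwx huv hw' hx'
      exact ⟨t, ⟨h1, h2⟩, h3⟩
  have c₃ := card_eq_outValency_mul hAut
    (H := MulAction.stabilizer G u ⊓ MulAction.stabilizer G v ⊓ MulAction.stabilizer G w)
    (v := w) (w := x) (fun _ hh ↦ hh.2) hwx fun x' hx' ↦ by
      obtain ⟨t, h1, h2, h3, h4⟩ := h.exists_smul huv hvw hwx huv hvw hx'
      exact ⟨t, ⟨⟨h1, h2⟩, h3⟩, h4⟩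
  rw [hk] at c₁ c₃
  refine ⟨u, g, outValency Γ v, hg1, ?_, ?_, hcard.trans c₁⟩
  · rw [hg2]
    rintro rfl
    exact hΓ.1 _ hvw
  · rw [hcard, c₁, c₂, c₃]
    rw [← mul_assoc, ← mul_assoc, ← pow_two, ← pow_succ]
    exact dvd_mul_right _ _

end Graphs

/-! ### Maximality of the normaliser of the torus, and the divisibility m ∣ 2ʳ |G : S| -/

section Groups

variable {S G : Type*} [Group S] [Group G]

lemma card_inf_mul_relIndex (H K : Subgroup G) :
    Nat.card (H ⊓ K : Subgroup G) * H.relIndex K = Nat.card K := by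
  rw [← (H.subgroupOf K).card_mul_index, ← Subgroup.subgroupOf_map_subtype,
    ← Nat.card_congr ((H.subgroupOf K).equivMapOfInjective _ K.subtype_injective).toEquiv]
  rfl

variable [Finite G]

/-- The index of `M` in its normaliser is a power of two. -/
lemma IsTorusLike.exists_card_eq [Finite S] {m : ℕ} {M N : Subgroup S} (hM : IsTorusLike m M)
    (hMN : M ≤ N) (hN : ∀ g ∈ N, ∀ x ∈ M, g * x * g⁻¹ ∈ M) :
    ∃ r, Nat.card N = m * m * 2 ^ r := by
  have hnormal : (M.subgroupOf N).Normal := ⟨fun x hx g ↦ hN g g.2 x hx⟩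
  have hp : IsPGroup 2 (N ⧸ M.subgroupOf N) := by
    intro x
    obtain ⟨g, rfl⟩ := QuotientGroup.mk_surjective x
    refine ⟨2, ?_⟩
    rw [← QuotientGroup.mk_pow, QuotientGroup.eq_one_iff]
    exact hM.pow_four_mem g (hN g g.2)
  have := Fact.mk Nat.prime_two
  obtain ⟨r, hr⟩ := IsPGroup.iff_card.1 hp
  refine ⟨r, ?_⟩
  rw [Subgroup.card_eq_card_quotient_mul_card_subgroup (M.subgroupOf N), hr,
    Nat.card_congr (Subgroup.subgroupOfEquivOfLe hMN).toEquiv, hM.card_eq, mul_comm]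

/-- If `g` conjugates `A` into the maximal subgroup `N_G(M)`, but does not lie in it, then `A`
contains no full torsion subgroup of `M`. -/
lemma IsTorusLike.card_comap_inf_dvd {i : S →* G} (hi : Function.Injective i) {m : ℕ}
    {M : Subgroup S} (hM : IsTorusLike m M) (hT : i.range.Normal)
    (hsoc : ∀ N : Subgroup G, N.Normal → N ≠ ⊥ → ∃ x ∈ N, ∃ y ∈ N, ¬ Commute x y)
    (hmax : IsCoatom (Subgroup.normalizer (M.map i : Set G))) {A : Subgroup G}
    {g : G} (hg : g ∉ Subgroup.normalizer (M.map i : Set G))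
    (hgA : ∀ a ∈ A, g * a * g⁻¹ ∈ Subgroup.normalizer (M.map i : Set G)) :
    Nat.card (A.comap i ⊓ M : Subgroup S) ∣ m := by
  refine hM.card_dvd _ inf_le_right fun p hp hpm ↦ ?_
  by_contra! H
  have hmem {x} (hx : x ∈ M) (hxp : x ^ p = 1) : i x ∈ A := (H x hx hxp).1
  let Q : Subgroup G :=
    { carrier := {y | ∃ x ∈ M, x ^ p = 1 ∧ i x = y}
      one_mem' := ⟨1, one_mem _, one_pow _, map_one _⟩
      mul_mem' := by
        rintro _ _ ⟨x, hx, hxp, rfl⟩ ⟨y, hy, hyp, rfl⟩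
        exact ⟨x * y, mul_mem hx hy, by rw [(hM.comm x hx y hy).mul_pow, hxp, hyp, one_mul],
          map_mul ..⟩
      inv_mem' := by
        rintro _ ⟨x, hx, hxp, rfl⟩
        exact ⟨x⁻¹, inv_mem hx, by rw [inv_pow, hxp, inv_one], map_inv ..⟩ }
  have hnorm {t : G} (ht : ∀ y ∈ Q, t * y * t⁻¹ ∈ Q) : t ∈ Subgroup.normalizer (Q : Set G) := by
    exact Subgroup.mem_normalizer_fintype ht
  have hN_conj {s : S} (hs : i s ∈ Subgroup.normalizer (M.map i : Set G)) {x} (hx : x ∈ M) :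
      s * x * s⁻¹ ∈ M := by
    have := (Subgroup.mem_normalizer_iff.1 hs (i x)).1 ⟨x, hx, rfl⟩
    rw [← map_mul, ← map_inv, ← map_mul] at this
    exact (Subgroup.mem_map_iff_mem hi).1 this
  -- Q is the p-torsion of the abelian group M, hence characteristic in it.
  have hle : Subgroup.normalizer (M.map i : Set G) ≤ Subgroup.normalizer (Q : Set G) := by
    intro t ht
    refine hnorm ?_
    rintro _ ⟨x, hx, hxp, rfl⟩
    obtain ⟨y, hy, hyx⟩ := (Subgroup.mem_normalizer_iff.1 ht (i x)).1 ⟨x, hx, rfl⟩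
    refine ⟨y, hy, hi ?_, hyx⟩
    rw [map_pow, hyx, conj_pow, ← map_pow, hxp]
    simp
  have hp2 : Nat.Coprime p 4 := by
    have : Odd p := hM.odd.of_dvd_nat hpm
    exact (Nat.Coprime.pow_right 2 this.coprime_two_right)
  have hgQ : g ∈ Subgroup.normalizer (Q : Set G) := by
    refine hnorm ?_
    rintro _ ⟨x, hx, hxp, rfl⟩
    obtain ⟨s, hs⟩ := hT.conj_mem (i x) ⟨x, rfl⟩ g
    have hsp : s ^ p = 1 := hi (by rw [map_pow, hs, conj_pow, ← map_pow, hxp]; simp)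
    refine ⟨s, ?_, hsp, hs⟩
    have hsN := hgA _ (hmem hx hxp)
    rw [← hs] at hsN
    -- Here s has sᵖ = 1 and s⁴ ∈ M with p odd; Bézout for p and 4 puts s itself in M.
    have h4 := hM.pow_four_mem s fun x hx ↦ hN_conj hsN hx
    have hbez := Nat.gcd_eq_gcd_ab p 4
    rw [hp2] at hbez
    rw [← zpow_one s, show (1 : ℤ) = (1 : ℕ) from rfl, hbez, zpow_add, zpow_mul, zpow_mul,
      zpow_natCast, hsp, one_zpow, one_mul]
    exact zpow_mem (by exact_mod_cast h4) _
  -- Either Q is a nontrivial abelian normal subgroup of G, contrary to `hsoc`, or Q has the same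
  -- normaliser as M, which does not contain g.
  rcases hmax.le_iff.1 hle with htop | heq
  · have hQn : Q.Normal := Subgroup.normalizer_eq_top_iff.1 htop
    have hQ : Q ≠ ⊥ := by
      have := Fact.mk hp
      have : Finite S := Finite.of_injective i hi
      obtain ⟨⟨x, hx⟩, hxp⟩ := exists_prime_orderOf_dvd_card' (G := M) p
        (hM.card_eq ▸ hpm.mul_left m)
      rw [Subgroup.orderOf_mk] at hxp
      rw [Subgroup.ne_bot_iff_exists_ne_one]
      refine ⟨⟨i x, x, hx, hxp ▸ pow_orderOf_eq_one x, rfl⟩, fun h ↦ hp.ne_one ?_⟩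
      have : i x = 1 := congrArg Subtype.val h
      rw [map_eq_one_iff i hi] at this
      rw [← hxp, this, orderOf_one]
    obtain ⟨_, ⟨x, hx, -, rfl⟩, _, ⟨y, hy, -, rfl⟩, hxy⟩ := hsoc Q hQn hQ
    exact hxy ((hM.comm x hx y hy).map i)
  · exact hg (heq ▸ hgQ)

lemma IsTorusLike.dvd_index {i : S →* G} (hi : Function.Injective i) {m : ℕ}
    {M : Subgroup S} (hM : IsTorusLike m M) (hT : i.range.Normal)
    (hsoc : ∀ N : Subgroup G, N.Normal → N ≠ ⊥ → ∃ x ∈ N, ∃ y ∈ N, ¬ Commute x y)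
    (hmax : IsCoatom (Subgroup.normalizer (M.map i : Set G))) {A : Subgroup G}
    (hA : A ≤ Subgroup.normalizer (M.map i : Set G))
    {g : G} (hg : g ∉ Subgroup.normalizer (M.map i : Set G))
    (hgA : ∀ a ∈ A, g * a * g⁻¹ ∈ Subgroup.normalizer (M.map i : Set G)) {k : ℕ}
    (hk : Nat.card (Subgroup.normalizer (M.map i : Set G)) = k * Nat.card A)
    (hk3 : k ^ 3 ∣ Nat.card (Subgroup.normalizer (M.map i : Set G))) :
    ∃ r, m ∣ 2 ^ r * i.range.index := by
  have hc := hM.card_comap_inf_dvd hi hT hsoc hmax hg hgA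
  have : Finite S := Finite.of_injective i hi
  set N := Subgroup.normalizer (M.map i : Set G) with hN
  have hMN : M.map i ≤ N := Subgroup.le_normalizer
  have hm : 0 < m := by have := hM.one_lt; omega
  have hnormal : ((M.map i).subgroupOf N).Normal := Subgroup.normal_in_normalizer
  have hcardM : Nat.card (M.map i) = m * m := by
    rw [← hM.card_eq]
    exact (Nat.card_congr (M.equivMapOfInjective i hi).toEquiv).symm
  -- Compare |N| = m² |N : M| with |N| = k |A ∩ M| |A : A ∩ M|: the last index divides |N : M| and
  -- |A ∩ M| divides m, so a factor m is left for k.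
  have hdvd : m ∣ k := by
    have hcA : Nat.card (A ⊓ M.map i : Subgroup G) ∣ m := by
      have : A ⊓ M.map i = (A.comap i ⊓ M).map i := by
        ext y
        constructor
        · rintro ⟨hy, x, hx, rfl⟩
          exact ⟨x, ⟨hy, hx⟩, rfl⟩
        · rintro ⟨x, ⟨hy, hx⟩, rfl⟩
          exact ⟨hy, x, hx, rfl⟩
      rw [this, ← Nat.card_congr ((A.comap i ⊓ M).equivMapOfInjective i hi).toEquiv]
      exact hc
    have h1 := Subgroup.relIndex_dvd_index_of_normal (H := (M.map i).subgroupOf N)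
      (K := A.subgroupOf N)
    have h2 : Nat.card (M.map i) * ((M.map i).subgroupOf N).index = Nat.card N := by
      have := card_inf_mul_relIndex (M.map i) N
      rwa [inf_eq_left.2 hMN] at this
    have h3 : Nat.card (A ⊓ M.map i : Subgroup G) * (M.map i).relIndex A = Nat.card A := by
      rw [inf_comm, card_inf_mul_relIndex]
    rw [Subgroup.relIndex_subgroupOf hA] at h1
    obtain ⟨t, ht⟩ := h1
    obtain ⟨d, hd⟩ := hcA
    rw [hk, ← h3, ht, hcardM] at h2
    generalize Nat.card (A ⊓ M.map i : Subgroup G) = c at *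
    generalize (M.map i).relIndex A = R at *
    refine ⟨d * t, ?_⟩
    have hcR : 0 < c * R := by
      rw [h3]; exact Nat.card_pos
    refine Nat.eq_of_mul_eq_mul_left hcR ?_
    calc c * R * k = k * (c * R) := by ring
      _ = m * m * (R * t) := h2.symm
      _ = c * R * (m * (d * t)) := by rw [hd]; ring
  obtain ⟨r, hr⟩ := hM.exists_card_eq (N := N.comap i) (fun x hx ↦ hMN ⟨x, hx, rfl⟩)
    fun g hg x hx ↦ by
      have := (Subgroup.mem_normalizer_iff.1 hg (i x)).1 ⟨x, hx, rfl⟩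
      rw [← map_mul, ← map_inv, ← map_mul] at this
      exact (Subgroup.mem_map_iff_mem hi).1 this
  refine ⟨r, ?_⟩
  -- The part of N inside S has order m² 2ʳ, and what lies outside contributes a divisor of |G : S|.
  have h1 : Nat.card N ∣ m * m * 2 ^ r * i.range.index := by
    have h2 : i.range.relIndex N ∣ i.range.index := Subgroup.relIndex_dvd_index_of_normal ..
    have h3 : Nat.card (N.comap i) * i.range.relIndex N = Nat.card N := by
      rw [← card_inf_mul_relIndex i.range N, ← Subgroup.map_comap_eq,
        ← Nat.card_congr ((N.comap i).equivMapOfInjective i hi).toEquiv]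
    rw [← h3, hr]
    exact Nat.mul_dvd_mul_left _ h2
  have h4 : m ^ 3 ∣ m * m * (2 ^ r * i.range.index) :=
    (pow_dvd_pow_of_dvd hdvd 3).trans (hk3.trans (by rwa [← mul_assoc]))
  rw [show m ^ 3 = m * m * m by ring] at h4
  exact Nat.dvd_of_mul_dvd_mul_left (by positivity) h4

end Groups

/-! ### The socle of an almost simple group -/

section AlmostSimpleGroups

variable {G : Type*} [Group G] [Finite G]

lemma exists_isMinimalNormal_le {N : Subgroup G} (hN : N.Normal) (hN1 : N ≠ ⊥) :
    ∃ K, IsMinimalNormal K ∧ K ≤ N := by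
  obtain ⟨K, hKN, hK⟩ := exists_minimal_le_of_wellFoundedLT
    (fun K : Subgroup G ↦ K.Normal ∧ K ≠ ⊥) N ⟨hN, hN1⟩
  exact ⟨K, ⟨hK.prop.1, hK.prop.2, fun L hL hL1 hLK ↦ hLK.antisymm (hK.le_of_le ⟨hL, hL1⟩ hLK)⟩, hKN⟩

lemma IsAlmostSimple.socle_properties (hG : IsAlmostSimple G) :
    (socle G).Normal ∧ ∀ N : Subgroup G, N.Normal → N ≠ ⊥ → socle G ≤ N ∧
      ∃ x ∈ socle G, ∃ y ∈ socle G, ¬ Commute x y := by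
  obtain ⟨T, hT, hTu, -, hcomm⟩ := hG
  have hsoc : socle G = T := by
    have : {N : Subgroup G | IsMinimalNormal N} = {T} := by
      ext N
      exact ⟨fun h ↦ hTu N h, fun h ↦ by rw [Set.mem_singleton_iff.1 h]; exact hT⟩
    rw [socle, this, sSup_singleton]
  rw [hsoc]
  refine ⟨hT.1, fun N hN hN1 ↦ ⟨?_, ?_⟩⟩
  · obtain ⟨K, hK, hKN⟩ := exists_isMinimalNormal_le hN hN1
    rwa [hTu K hK] at hKN
  · by_contra! H
    exact hcomm ⟨⟨fun x y ↦ Subtype.ext (H x x.2 y y.2)⟩⟩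

/-- The action of `G` by conjugation on a normal subgroup, given as the range of `i`. -/
lemma exists_conj_hom {S : Type*} [Group S] {i : S →* G} (hi : Function.Injective i)
    (hT : i.range.Normal) : ∃ φ : G →* MulAut S, ∀ g x, i (φ g x) = g * i x * g⁻¹ := by
  let f := MonoidHom.ofInjective hi
  have hf (y : i.range) : i (f.symm y) = y := congrArg Subtype.val (f.apply_symm_apply y)
  refine ⟨(MulAut.congr f.symm).toMonoidHom.comp MulAut.conjNormal, fun g x ↦ ?_⟩
  exact hf _

end AlmostSimpleGroups

/-! ### Sp₄(F) as the socle -/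

section Center

variable {F : Type*} [Field F] [CharP F 2]

/-- A central g fixes every transvection under conjugation, hence every vector, as transvections
determine their vectors in characteristic two. -/
lemma center_sp4_eq_bot : Subgroup.center (Sp4 F) = ⊥ := by
  rw [Subgroup.eq_bot_iff_forall]
  intro g hg
  refine Sp4.ext_ap fun v ↦ tv_injective ?_
  rw [← conj_tv, ← Subgroup.mem_center_iff.1 hg, mul_inv_cancel_right, ap_one]

/-- The embedding of `Sp₄(F)` in `G` as the socle. -/
lemma exists_embedding {G : Type*} [Group G] (e : socle G ≃* PSp4 F) :
    ∃ i : Sp4 F →* G, Function.Injective i ∧ i.range = socle G ∧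
      ∀ M, inGroup e M = M.map i := by
  have hmk : Function.Injective (QuotientGroup.mk' (Subgroup.center (Sp4 F))) := by
    rw [← MonoidHom.ker_eq_bot_iff, QuotientGroup.ker_mk', center_sp4_eq_bot]
  refine ⟨(socle G).subtype.comp (e.symm.toMonoidHom.comp (QuotientGroup.mk' _)),
    (socle G).subtype_injective.comp (e.symm.injective.comp hmk), ?_, fun M ↦ ?_⟩
  · have hsurj : Function.Surjective (e.symm.toMonoidHom.comp
        (QuotientGroup.mk' (Subgroup.center (Sp4 F)))) :=
      e.symm.surjective.comp (QuotientGroup.mk'_surjective _)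
    rw [MonoidHom.range_comp, MonoidHom.range_eq_top.2 hsurj, ← MonoidHom.range_eq_map,
      Subgroup.range_subtype]
  · rw [inGroup, ← Subgroup.map_map, ← Subgroup.map_map]
    congr 1
    exact Subgroup.comap_equiv_eq_map_symm e _

end Center

end ArcTransitive

theorem proposition4p23 {F : Type*} [Field F] [Finite F] [CharP F 2]
    {Ω : Type*} [Finite Ω] (Γ : Digraph Ω) (hΓ : ArcTransitive.IsOriented Γ)
    (hval : ∀ x : Ω, 3 ≤ ArcTransitive.outValency Γ x)
    {G : Type*} [Group G] (hG : ArcTransitive.IsAlmostSimple G)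
    (e : ArcTransitive.socle G ≃* ArcTransitive.PSp4 F)
    [MulAction G Ω] [FaithfulSMul G Ω] [MulAction.IsPreprimitive G Ω]
    (hAut : ArcTransitive.ActsByAut G Γ)
    (v : Ω) (hv : ArcTransitive.IsMaximalA2 e (MulAction.stabilizer G v)) :
    ¬ ArcTransitive.IsArcTransitive G Γ 3 := by
  intro h3
  have hfinG : Finite G :=
    Finite.of_injective (MulAction.toPermHom G Ω) MulAction.toPerm_injective
  obtain ⟨hmax, M, hM, hstab⟩ := hv
  obtain ⟨hTn, hsoc⟩ := hG.socle_properties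
  obtain ⟨i, hi, hrange, hin⟩ := ArcTransitive.exists_embedding e
  rw [hin] at hstab
  rw [← hrange] at hTn hsoc
  obtain ⟨n, hn⟩ : ∃ n : ℕ, Nat.card F = 2 ^ n := by
    have := Fintype.ofFinite F
    obtain ⟨n, -, hn⟩ := FiniteField.card F 2
    exact ⟨n, by rw [Nat.card_eq_fintype_card, hn]⟩
  obtain ⟨φ, hφ⟩ := ArcTransitive.exists_conj_hom hi hTn
  have hφi (s x) : φ (i s) x = s * x * s⁻¹ := hi (by rw [hφ]; simp)
  -- A nontrivial kernel would contain the socle, which would then centralise itself and be abelian.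
  have hφinj : Function.Injective φ := by
    rw [← MonoidHom.ker_eq_bot_iff]
    by_contra hker
    obtain ⟨hle, _, ⟨x, rfl⟩, _, ⟨y, rfl⟩, hxy⟩ := hsoc _ φ.normal_ker hker
    refine hxy ?_
    have h1 : φ (i x) = 1 := hle ⟨x, rfl⟩
    have h2 := hφ (i x) y
    rw [h1, MulAut.one_apply] at h2
    exact (eq_mul_inv_iff_mul_eq.1 h2).symm
  obtain ⟨j, k', hj, hk', hindex⟩ := ArcTransitive.exists_index_range_eq φ hφinj hi hφi hn
  obtain ⟨m, hnm, hM⟩ := hM.exists_isTorusLike hn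
  obtain ⟨u, g, k, hgu, hgv, hk3, hk⟩ := h3.exists_arc_stabilizer hΓ
    (fun x ↦ by have := hval x; omega) hAut v
  rw [hstab] at hmax hk3 hk
  obtain ⟨r, hr⟩ := hM.dvd_index hi hTn (fun N hN hN1 ↦ by
      obtain ⟨hle, x, hx, y, hy, hxy⟩ := hsoc N hN hN1
      exact ⟨x, hle hx, y, hle hy, hxy⟩) hmax (g := g) inf_le_right
    (fun h ↦ hgv (by rwa [← hstab] at h)) (fun a ha ↦ by
      have h1 : a • u = u := ha.1
      rw [← hstab, MulAction.mem_stabilizer_iff, ← hgu, mul_smul, mul_smul, inv_smul_smul, h1])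
    hk hk3
  rw [hindex] at hr
  have hne : k' ≠ 0 := by
    rintro rfl
    exact i.range.index_ne_zero_of_finite (by rw [hindex, mul_zero])
  have h2 : m.Coprime 2 := hM.odd.coprime_two_right
  -- As m is odd, neither 2ʳ nor j contributes to it; then m ≤ k' ≤ n contradicts n < m.
  have hdvd : m ∣ k' := by
    have h4 := (h2.pow_right r).dvd_of_dvd_mul_left hr
    rcases hj with rfl | rfl
    · rwa [one_mul] at h4
    · exact h2.dvd_of_dvd_mul_left h4
  have := Nat.le_of_dvd (Nat.pos_of_ne_zero hne) hdvd
  omega
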